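/- A source gets new versions at the points of a Poisson process of rate $\lambda_e$. There are $n = mk$ users, divided into $m\ge 1$ clusters of $k\ge 1$ users; each cluster has its own cluster head. The $m$ cluster heads form a bidirectional ring, and so do the $k$ users of each cluster. The source sends its version to each cluster head at rate $\lambda_s/m$; each head sends its stored version to each of its two neighbouring heads at rate $\lambda_{ca}/2$ and to each user of its cluster at rate $\lambda_{cb}/k$; each user sends its stored version to each of its two ring neighbours at rate $\lambda/2$. All these transmissions take place at the points of independent Poisson processes, independent also of the process of new versions, and a receiver keeps the newer of its own version and the received one. At time $0$ the stored versions are deterministic, no head is ahead of the source and no user is ahead of its head. The version age $\Delta_i(t)$ of user $i$ is the number of versions by which its stored version is behind the source at time $t$. Fix $\lambda_e,\lambda_s,\lambda_{ca},\lambda_{cb},\lambda>0$ (independent of $m,k,n$). Then for all $m,k\ge1$ and each user $i$, $\Delta_i(t)$ is integrable for all $t\ge 0$ and the limit $\Delta(m,k)=\lim_{t\to\infty}\mathbb E[\Delta_i(t)]$ exists in $\mathbb R$; it depends only on $m$, $k$ and the rates, and is the same for all users and all such initial versions. Moreover: 1. As $m\to\infty$ and $k\to\infty$ (jointly and independently of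 each other), $$\Delta(m,k)\;\sim\;\sqrt{\frac{\pi}{2}}\,\frac{\lambda_e}{\sqrt{\lambda_s\lambda_{ca}}}\,\sqrt m\;+\;\sqrt{\frac{\pi}{2}}\,\frac{\lambda_e}{\sqrt{\lambda\lambda_{cb}}}\,\sqrt k ,$$ that is, the ratio of the two sides tends to $1$. 2. With $m=k=\sqrt n$ ($n\ge 1$ a perfect square), the average version age of a user is $O(n^{1/4})$: there is a constant $C$, depending only on the rates, with $\Delta(\sqrt n,\sqrt n)\le C\,n^{1/4}$ for all such $n$. -/

import Mathlib

open MeasureTheory ProbabilityTheory Filter Topology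
open scoped NNReal

namespace ClusteredGossip

/-- The source, the `m` cluster heads, and the `k` users of each of the `m` clusters.
Heads, and users within a cluster, are indexed cyclically. -/
inductive Vertex (m k : ℕ) : Type
  | source : Vertex m k
  | head (c : ZMod m) : Vertex m k
  | user (c : ZMod m) (i : ZMod k) : Vertex m k
  deriving DecidableEq

/-- The kinds of events; each one has its own Poisson clock. The `Bool` selects one of the two
neighbours on a bidirectional ring. -/
inductive Event (m k : ℕ) : Type
  | newVersion : Event m k
  | sourceToHead (c : ZMod m) : Event m k
  | headToHead (c : ZMod m) (forward : Bool) : Event m k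
  | headToUser (c : ZMod m) (i : ZMod k) : Event m k
  | userToUser (c : ZMod m) (i : ZMod k) (forward : Bool) : Event m k

/-- The next or the previous position on a ring. -/
def ringNeighbour {l : ℕ} (i : ZMod l) (forward : Bool) : ZMod l :=
  if forward then i + 1 else i - 1

/-- The update rates: `lamE` is the rate at which the source gets new versions, `lamS` the total
rate of the source into the heads, `lamCA` the total rate of a head into its two neighbouring
heads, `lamCB` the total rate of a head into its own cluster, `lam` the total rate of a user into
its two neighbours. -/
structure Rates where
  lamE : ℝ≥0
  lamS : ℝ≥0
  lamCA : ℝ≥0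
  lamCB : ℝ≥0
  lam : ℝ≥0

/-- The rate of the Poisson clock of each event: total rates are split uniformly. -/
noncomputable def Event.rate {m k : ℕ} (r : Rates) : Event m k → ℝ≥0
  | .newVersion => r.lamE
  | .sourceToHead _ => r.lamS / (m : ℝ≥0)
  | .headToHead _ _ => r.lamCA / 2
  | .headToUser _ _ => r.lamCB / (k : ℝ≥0)
  | .userToUser _ _ _ => r.lam / 2

/-- After `v` sends its stored version to `w`, the latter keeps the newer of the two. -/
def send {m k : ℕ} (v w : Vertex m k) (V : Vertex m k → ℕ) : Vertex m k → ℕ :=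
  Function.update V w (max (V w) (V v))

/-- The effect of an event on the vector of stored version numbers. -/
def Event.act {m k : ℕ} : Event m k → (Vertex m k → ℕ) → (Vertex m k → ℕ)
  | .newVersion, V => Function.update V .source (V .source + 1)
  | .sourceToHead c, V => send .source (.head c) V
  | .headToHead c b, V => send (.head c) (.head (ringNeighbour c b)) V
  | .headToUser c i, V => send (.head c) (.user c i) V
  | .userToUser c i b, V => send (.user c i) (.user c (ringNeighbour i b)) V

/-- `N` counts the rings of a Poisson process with constant rate `rate`. -/
structure IsPoissonProcess {Ω : Type*} [MeasurableSpace Ω] (P : Measure Ω) (rate : ℝ≥0)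
    (N : ℝ≥0 → Ω → ℕ) : Prop where
  measurable : ∀ t, Measurable (N t)
  zero : ∀ ω, N 0 ω = 0
  mono : ∀ ω, Monotone fun t => N t ω
  rightCont : ∀ ω t, ContinuousWithinAt (fun s => N s ω) (Set.Ici t) t
  law : ∀ s t, s ≤ t → P.map (fun ω => N t ω - N s ω) = poissonMeasure (rate * (t - s))
  indepIncrements : HasIndepIncrements N P

/-- A realization of the gossip network with `m` clusters of `k` users on a probability space:
`N e t` is the number of events of kind `e` in the time interval `(0, t]`, and `V t ω v` is the
number of the version stored at `v` at time `t`.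

The fields `const_of_no_event` and `act_of_single_event` say that the stored versions only change
at events, and that an event changes them by its action. They determine `V` almost surely, since
almost surely no two events happen at the same time. -/
structure IsRealization {m k : ℕ} {Ω : Type*} [MeasurableSpace Ω] (P : Measure Ω) (r : Rates)
    (N : Event m k → ℝ≥0 → Ω → ℕ) (V : ℝ≥0 → Ω → Vertex m k → ℕ) : Prop where
  poisson : ∀ e, IsPoissonProcess P (e.rate r) (N e)
  indep : iIndepFun (fun (e : Event m k) (ω : Ω) (t : ℝ≥0) => N e t ω) P
  measurable : ∀ t v, Measurable fun ω => V t ω v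
  /-- The initial versions are arbitrary constants, but no head is ahead of the source and no user
  is ahead of its head. -/
  initial : ∃ V₀ : Vertex m k → ℕ, (∀ ω, V 0 ω = V₀) ∧
    (∀ c, V₀ (.head c) ≤ V₀ .source) ∧ (∀ c i, V₀ (.user c i) ≤ V₀ (.head c))
  const_of_no_event : ∀ ω s t, s ≤ t → (∀ e, N e t ω = N e s ω) → V t ω = V s ω
  act_of_single_event : ∀ ω s t e, s ≤ t → N e t ω = N e s ω + 1 →
    (∀ e', e' ≠ e → N e' t ω = N e' s ω) → V t ω = e.act (V s ω)

/-- The version age at `v`: how many versions `v` is behind the source. -/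
def age {m k : ℕ} (V : Vertex m k → ℕ) (v : Vertex m k) : ℝ :=
  (V .source : ℝ) - (V v : ℝ)

end ClusteredGossip

/-! Single ages do not satisfy a closed system of equations, but ages of sets do. Let the age of a
set `S` be the source's version number minus the largest one in `S`. A transmission from `v` into
`S` turns it into the age of `insert v S`, so the mean set ages satisfy a linear system: `lamE`
plus, for each possible transmission into `S`, its rate times the difference of the mean ages of
`insert v S` and `S` (`drift`, `IsRealization.hasDerivWithinAt_meanAge`).

The order source ≥ head ≥ users is preserved. Hence inserting the source gives age zero, and
inserting a cluster's head into a set of its users gives the age of the head. On a ring an arc grows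
only through its two outer neighbours. The system thus becomes triangular over arcs: the full ring
is driven by its parent alone, each shorter arc by the parent and two arcs one longer. Scalar
equations `y' = g - a y` with convergent `g` then give all limits by induction (`tendsto_arc`). The
parent's limit enters additively, so the limiting age of a user is exactly `ringAge` of the ring of
heads plus `ringAge` of its cluster.

Unrolling the recursion writes `ringAge` as a sum of products `∏ (1 + α i / l)⁻¹` with `α = a / b`.
At `s ≈ x √l` such a product tends to `exp (-α x² / 2)`, so the sum divided by `√l` tends to a
Gaussian integral (`tendsto_ringAge_div_sqrt`), which is the source of `√(π / 2)`.

The linear system is derived from the axioms of a realization. On a fine time grid it is unlikely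
that some cell has two events, and otherwise the state is a function of the past increments; hence
it is independent of the future ones (`IsRealization.indepFun_V_incr`). -/

namespace ClusteredGossip

/-! ### Ages of sets of vertices and their change under one event. -/

section

variable {m k : ℕ}

instance [NeZero m] [NeZero k] : Finite (Vertex m k) :=
  Finite.of_injective
    (fun v : Vertex m k => match v with
      | .source => (Sum.inl () : Unit ⊕ ZMod m ⊕ ZMod m × ZMod k)
      | .head c => .inr (.inl c)
      | .user c i => .inr (.inr (c, i)))
    (by intro v w h; cases v <;> cases w <;> simp_all)

/-- The events, listed by kind. -/
def eventEquiv (m k : ℕ) : Event m k ≃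
    Unit ⊕ ZMod m ⊕ (ZMod m × Bool) ⊕ (ZMod m × ZMod k) ⊕ (ZMod m × ZMod k × Bool) where
  toFun
    | .newVersion => .inl ()
    | .sourceToHead c => .inr (.inl c)
    | .headToHead c b => .inr (.inr (.inl (c, b)))
    | .headToUser c i => .inr (.inr (.inr (.inl (c, i))))
    | .userToUser c i b => .inr (.inr (.inr (.inr (c, i, b))))
  invFun
    | .inl _ => .newVersion
    | .inr (.inl c) => .sourceToHead c
    | .inr (.inr (.inl (c, b))) => .headToHead c b
    | .inr (.inr (.inr (.inl (c, i)))) => .headToUser c i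
    | .inr (.inr (.inr (.inr (c, i, b)))) => .userToUser c i b
  left_inv e := by cases e <;> rfl
  right_inv e := by rcases e with _ | _ | ⟨_, _⟩ | ⟨_, _⟩ | ⟨_, _, _⟩ <;> rfl

noncomputable instance [NeZero m] [NeZero k] : Fintype (Event m k) :=
  Fintype.ofEquiv _ (eventEquiv m k).symm

lemma sum_event [NeZero m] [NeZero k] (f : Event m k → ℝ) :
    ∑ e, f e = f .newVersion + (∑ c, f (.sourceToHead c)) + (∑ c, ∑ b, f (.headToHead c b)) +
      (∑ c, ∑ i, f (.headToUser c i)) + ∑ c, ∑ i, ∑ b, f (.userToUser c i b) := by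
  rw [← (eventEquiv m k).symm.sum_comp]
  simp only [Fintype.sum_sum_type, Fintype.sum_prod_type, Finset.univ_unique, Finset.sum_singleton]
  simp only [eventEquiv, Equiv.coe_fn_symm_mk]
  ring

/-- No head is ahead of the source and no user is ahead of its head. -/
def Ordered (x : Vertex m k → ℕ) : Prop :=
  (∀ c, x (.head c) ≤ x .source) ∧ ∀ c i, x (.user c i) ≤ x (.head c)

lemma Ordered.le_source {x : Vertex m k → ℕ} (hx : Ordered x) (v : Vertex m k) :
    x v ≤ x .source := by
  cases v with
  | source => exact le_rfl
  | head c => exact hx.1 c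
  | user c i => exact (hx.2 c i).trans (hx.1 c)

lemma Ordered.act {x : Vertex m k → ℕ} (hx : Ordered x) (e : Event m k) : Ordered (e.act x) := by
  obtain ⟨h1, h2⟩ := hx
  cases e <;> refine ⟨fun c => ?_, fun c i => ?_⟩ <;>
    simp only [Event.act, send, Function.update_apply] <;> grind

lemma act_source [DecidableEq (Event m k)] (e : Event m k) (x : Vertex m k → ℕ) :
    e.act x .source = x .source + if e = .newVersion then 1 else 0 := by
  cases e <;> simp [Event.act, send]

/-- The version age of a set of vertices: the age of the newest version stored in it. -/
def setAge (S : Finset (Vertex m k)) (x : Vertex m k → ℕ) : ℝ :=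
  (x .source : ℝ) - ((S.sup x : ℕ) : ℝ)

lemma setAge_singleton (v : Vertex m k) (x : Vertex m k → ℕ) : setAge {v} x = age x v := by
  simp [setAge, age]

lemma setAge_le (S : Finset (Vertex m k)) (x : Vertex m k → ℕ) : setAge S x ≤ x .source := by
  simp [setAge]

lemma Ordered.setAge_nonneg {x : Vertex m k → ℕ} (hx : Ordered x) (S : Finset (Vertex m k)) :
    0 ≤ setAge S x := by
  simp only [setAge, sub_nonneg, Nat.cast_le]
  exact Finset.sup_le fun v _ => hx.le_source v

lemma Ordered.setAge_insert_source {x : Vertex m k → ℕ} (hx : Ordered x)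
    (S : Finset (Vertex m k)) : setAge (insert .source S) x = 0 := by
  rw [setAge, Finset.sup_insert, sup_eq_left.2 (Finset.sup_le fun v _ => hx.le_source v), sub_self]

lemma Ordered.setAge_insert_head {x : Vertex m k → ℕ} (hx : Ordered x) (c : ZMod m)
    (A : Finset (ZMod k)) :
    setAge (insert (.head c) (A.image (.user c))) x = setAge {.head c} x := by
  rw [setAge, setAge, Finset.sup_insert, sup_eq_left.2 (Finset.sup_le fun v hv => ?_),
    Finset.sup_singleton]
  obtain ⟨i, -, rfl⟩ := Finset.mem_image.1 hv
  exact hx.2 c i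

/-- This is what closes the equations for set ages: a transmission into `S` acts on the maximum as
if the sender had joined `S`. -/
lemma sup_send (v w : Vertex m k) (x : Vertex m k → ℕ) (S : Finset (Vertex m k)) :
    S.sup (send v w x) = if w ∈ S then (insert v S).sup x else S.sup x := by
  split_ifs with hw
  · apply le_antisymm
    · refine Finset.sup_le fun u hu => ?_
      rcases eq_or_ne u w with rfl | h
      · simp only [send, Function.update_self]
        exact sup_le (Finset.le_sup (Finset.mem_insert_of_mem hu))
          (Finset.le_sup (Finset.mem_insert_self _ _))
      · simp only [send, Function.update_of_ne h]
        exact Finset.le_sup (Finset.mem_insert_of_mem hu)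
    · refine Finset.sup_le fun u hu => ?_
      rcases Finset.mem_insert.1 hu with rfl | hu
      · refine le_trans ?_ (Finset.le_sup hw)
        simp [send]
      · refine le_trans ?_ (Finset.le_sup hu)
        rcases eq_or_ne u w with rfl | h <;> simp [send, *]
  · refine Finset.sup_congr rfl fun u hu => ?_
    rw [send, Function.update_of_ne]
    rintro rfl
    exact hw hu

lemma setAge_send (v w : Vertex m k) (hw : w ≠ .source) (x : Vertex m k → ℕ)
    (S : Finset (Vertex m k)) :
    setAge S (send v w x) = if w ∈ S then setAge (insert v S) x else setAge S x := by
  have : send v w x .source = x .source := by rw [send, Function.update_of_ne hw.symm]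
  rw [setAge, sup_send, this]
  split_ifs <;> rfl

lemma setAge_newVersion (x : Vertex m k → ℕ) (S : Finset (Vertex m k)) (hS : .source ∉ S) :
    setAge S (Event.newVersion.act x) = setAge S x + 1 := by
  have : S.sup (Event.newVersion.act x) = S.sup x := by
    refine Finset.sup_congr rfl fun u hu => ?_
    rw [Event.act, Function.update_of_ne]
    rintro rfl
    exact hS hu
  rw [setAge, setAge, this]
  simp only [Event.act, Function.update_self]
  push_cast
  ring

section Chain

open Classical in
/-- One step of the chain: if `J` records exactly one event, this event acts. -/
noncomputable def step (J : Event m k → ℕ) (x : Vertex m k → ℕ) : Vertex m k → ℕ :=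
  if h : ∃ e, J e = 1 ∧ ∀ e', e' ≠ e → J e' = 0 then h.choose.act x else x

/-- The stored versions after the first `n` of a sequence of steps. -/
noncomputable def chain (J : ℕ → Event m k → ℕ) (x : Vertex m k → ℕ) : ℕ → Vertex m k → ℕ
  | 0 => x
  | n + 1 => step (J n) (chain J x n)

lemma chain_congr {J J' : ℕ → Event m k → ℕ} (x : Vertex m k → ℕ) {n : ℕ}
    (h : ∀ j < n, J j = J' j) : chain J x n = chain J' x n := by
  induction n with
  | zero => rfl
  | succ n ih =>
    rw [chain, chain, ih fun j hj => h j (hj.trans n.lt_succ_self), h n n.lt_succ_self]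

lemma Ordered.step {x : Vertex m k → ℕ} (hx : Ordered x) (J : Event m k → ℕ) :
    Ordered (step J x) := by
  unfold ClusteredGossip.step
  split_ifs with h
  · exact hx.act _
  · exact hx

variable [NeZero m] [NeZero k]

lemma eq_zero_or_single_of_sum_le_one {J : Event m k → ℕ} (h : ∑ e, J e ≤ 1) :
    (∀ e, J e = 0) ∨ ∃ e, J e = 1 ∧ ∀ e', e' ≠ e → J e' = 0 := by
  classical
  by_cases h0 : ∀ e, J e = 0
  · exact .inl h0
  push Not at h0
  obtain ⟨e, he⟩ := h0
  have h1 := Finset.add_sum_erase Finset.univ J (Finset.mem_univ e)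
  refine .inr ⟨e, by omega, fun e' hne => ?_⟩
  have : ∑ x ∈ Finset.univ.erase e, J x = 0 := by omega
  exact Finset.sum_eq_zero_iff.1 this e' (by simp [hne])

lemma step_source {J : Event m k → ℕ} (hJ : ∑ e, J e ≤ 1) (x : Vertex m k → ℕ) :
    step J x .source = x .source + J .newVersion := by
  classical
  unfold step
  split_ifs with h
  · obtain ⟨h1, h2⟩ := h.choose_spec
    rw [act_source]
    split_ifs with h3
    · rw [← h3, h1]
    · rw [h2 _ (Ne.symm h3)]
  · rcases eq_zero_or_single_of_sum_le_one hJ with h0 | h0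
    · simp [h0]
    · exact absurd h0 h

end Chain

end

/-! ### Poisson moments, discretization in time, and independence of the state from future events.
-/

section

/-- With `p n` the Poisson weights, `n * p n = r * p (n - 1)`; shifting the index reduces each
moment to lower ones. -/
lemma hasSum_mul_poisson (r : ℝ≥0) :
    HasSum (fun n : ℕ => Real.exp (-r) * (r : ℝ) ^ n / (n.factorial : ℝ) * n) r := by
  rw [← hasSum_nat_add_iff' 1]
  convert! (hasSum_one_poissonMeasure r).mul_left (r : ℝ) using 1
  · funext n
    have : (n.factorial : ℝ) ≠ 0 := by positivity
    rw [Nat.factorial_succ]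
    push_cast
    field_simp
    ring
  · simp

lemma hasSum_sq_mul_poisson (r : ℝ≥0) :
    HasSum (fun n : ℕ => Real.exp (-r) * (r : ℝ) ^ n / (n.factorial : ℝ) * (n : ℝ) ^ 2)
      ((r : ℝ) ^ 2 + r) := by
  rw [← hasSum_nat_add_iff' 1]
  convert! ((hasSum_mul_poisson r).add (hasSum_one_poissonMeasure r)).mul_left (r : ℝ) using 1
  · funext n
    have : (n.factorial : ℝ) ≠ 0 := by positivity
    rw [Nat.factorial_succ]
    push_cast
    field_simp
    ring
  · simp
    ring

lemma integrable_cast_poissonMeasure (r : ℝ≥0) :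
    Integrable (fun n : ℕ => (n : ℝ)) (poissonMeasure r) := by
  rw [integrable_poissonMeasure_iff]
  simpa using (hasSum_mul_poisson r).summable

lemma integral_cast_poissonMeasure (r : ℝ≥0) : ∫ n : ℕ, (n : ℝ) ∂(poissonMeasure r) = r := by
  rw [integral_poissonMeasure]
  simpa using (hasSum_mul_poisson r).tsum_eq

lemma integrable_cast_sq_poissonMeasure (r : ℝ≥0) :
    Integrable (fun n : ℕ => (n : ℝ) ^ 2) (poissonMeasure r) := by
  rw [integrable_poissonMeasure_iff]
  simpa using (hasSum_sq_mul_poisson r).summable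

lemma integral_cast_sq_poissonMeasure (r : ℝ≥0) :
    ∫ n : ℕ, (n : ℝ) ^ 2 ∂(poissonMeasure r) = (r : ℝ) ^ 2 + r := by
  rw [integral_poissonMeasure]
  simpa using (hasSum_sq_mul_poisson r).tsum_eq

variable {m k : ℕ} {Ω : Type*}

/-- The numbers of events of each kind in the time interval `(s, u]`. -/
def incr (N : Event m k → ℝ≥0 → Ω → ℕ) (s u : ℝ≥0) (ω : Ω) (e : Event m k) : ℕ :=
  N e u ω - N e s ω

/-- The times `t * j / n` for `j ≤ n`, followed by `t + h`. -/
noncomputable def gridTime (t h : ℝ≥0) (n j : ℕ) : ℝ≥0 := if j ≤ n then t * j / n else t + h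

lemma gridTime_mono (t h : ℝ≥0) {n : ℕ} (hn : 0 < n) : Monotone (gridTime t h n) := by
  have hn' : (0 : ℝ≥0) < n := by exact_mod_cast hn
  intro i j hij
  simp only [gridTime]
  split_ifs with h1 h2 h3
  · have : (i : ℝ≥0) ≤ j := by exact_mod_cast hij
    gcongr
  · have : (i : ℝ≥0) ≤ n := by exact_mod_cast h1
    calc t * i / n ≤ t * n / n := by gcongr
      _ = t := by field_simp
      _ ≤ t + h := by simp
  · omega
  · exact le_rfl

lemma gridTime_zero (t h : ℝ≥0) (n : ℕ) : gridTime t h n 0 = 0 := by simp [gridTime]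

lemma gridTime_self (t h : ℝ≥0) {n : ℕ} (hn : 0 < n) : gridTime t h n n = t := by
  have hn' : (n : ℝ≥0) ≠ 0 := by positivity
  simp only [gridTime, le_refl, if_true]
  field_simp

lemma gridTime_succ_self (t h : ℝ≥0) (n : ℕ) : gridTime t h n (n + 1) = t + h := by
  simp [gridTime]

lemma gridTime_sub (t h : ℝ≥0) {n j : ℕ} (hj : j < n) :
    ((gridTime t h n (j + 1) : ℝ≥0) : ℝ) - gridTime t h n j = t / n := by
  simp only [gridTime, if_pos hj.le, if_pos (Nat.succ_le_of_lt hj)]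
  push_cast
  ring

/-- The total event rate. -/
noncomputable def totalRate (m k : ℕ) [NeZero m] [NeZero k] (r : Rates) :
    ℝ :=
  ∑ e : Event m k, (e.rate r : ℝ)

/-- The number of ordered pairs of distinct events in `(s, u]`. -/
noncomputable def pairs [NeZero m] [NeZero k] (J : Event m k → ℕ) : ℝ :=
  (∑ e, (J e : ℝ)) ^ 2 - ∑ e, (J e : ℝ)

/-- Outside of this set, every interval of the grid has at most one event. -/
def crowded [NeZero m] [NeZero k] (N : Event m k → ℝ≥0 → Ω → ℕ) (t h : ℝ≥0) (n : ℕ) : Set Ω :=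
  ⋃ j ∈ Finset.range n, {ω | 2 ≤ ∑ e, incr N (gridTime t h n j) (gridTime t h n (j + 1)) ω e}

/-- The version vector that is computed from the increments on a grid. -/
noncomputable def gridChain (N : Event m k → ℝ≥0 → Ω → ℕ) (t h : ℝ≥0)
    (n : ℕ) (x : Vertex m k → ℕ) (ω : Ω) : ℕ → Vertex m k → ℕ :=
  chain (fun j => incr N (gridTime t h n j) (gridTime t h n (j + 1)) ω) x

variable [MeasurableSpace Ω] {P : Measure Ω} {r : Rates}
  {N : Event m k → ℝ≥0 → Ω → ℕ} {V : ℝ≥0 → Ω → Vertex m k → ℕ}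

namespace IsRealization

lemma measurable_incr (hR : IsRealization P r N V) (s u : ℝ≥0) (e : Event m k) :
    Measurable fun ω => incr N s u ω e :=
  ((hR.poisson e).measurable u).sub ((hR.poisson e).measurable s)

lemma map_incr (hR : IsRealization P r N V) {s u : ℝ≥0} (hsu : s ≤ u) (e : Event m k) :
    P.map (fun ω => incr N s u ω e) = poissonMeasure (e.rate r * (u - s)) :=
  (hR.poisson e).law s u hsu

lemma integrable_incr (hR : IsRealization P r N V) {s u : ℝ≥0} (hsu : s ≤ u) (e : Event m k) :
    Integrable (fun ω => (incr N s u ω e : ℝ)) P := by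
  have h := integrable_cast_poissonMeasure (e.rate r * (u - s))
  rw [← hR.map_incr hsu e] at h
  exact (integrable_map_measure .of_discrete (hR.measurable_incr s u e).aemeasurable).1 h

lemma integral_incr (hR : IsRealization P r N V) {s u : ℝ≥0} (hsu : s ≤ u) (e : Event m k) :
    ∫ ω, (incr N s u ω e : ℝ) ∂P = e.rate r * ((u : ℝ) - s) := by
  have h := integral_cast_poissonMeasure (e.rate r * (u - s))
  rw [← hR.map_incr hsu e, integral_map (hR.measurable_incr s u e).aemeasurable .of_discrete] at h
  rw [h, NNReal.coe_mul, NNReal.coe_sub hsu]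

lemma integrable_incr_sq (hR : IsRealization P r N V) {s u : ℝ≥0} (hsu : s ≤ u) (e : Event m k) :
    Integrable (fun ω => (incr N s u ω e : ℝ) ^ 2) P := by
  have h := integrable_cast_sq_poissonMeasure (e.rate r * (u - s))
  rw [← hR.map_incr hsu e] at h
  exact (integrable_map_measure .of_discrete (hR.measurable_incr s u e).aemeasurable).1 h

lemma integral_incr_sq (hR : IsRealization P r N V) {s u : ℝ≥0} (hsu : s ≤ u) (e : Event m k) :
    ∫ ω, (incr N s u ω e : ℝ) ^ 2 ∂P =
      (e.rate r * ((u : ℝ) - s)) ^ 2 + e.rate r * ((u : ℝ) - s) := by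
  have h := integral_cast_sq_poissonMeasure (e.rate r * (u - s))
  rw [← hR.map_incr hsu e, integral_map (hR.measurable_incr s u e).aemeasurable .of_discrete] at h
  rw [h, NNReal.coe_mul, NNReal.coe_sub hsu]

lemma iIndepFun_incr (hR : IsRealization P r N V) {τ : ℕ → ℝ≥0} (hτ : Monotone τ) :
    iIndepFun (fun (p : Event m k × ℕ) ω => incr N (τ p.2) (τ (p.2 + 1)) ω p.1) P := by
  refine iIndepFun_uncurry' (X := fun e j ω => incr N (τ j) (τ (j + 1)) ω e)
    (fun e j => hR.measurable_incr _ _ e) ?_ fun e => (hR.poisson e).indepIncrements.nat hτ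
  exact hR.indep.comp (fun e (x : ℝ≥0 → ℕ) j => x (τ (j + 1)) - x (τ j)) fun e =>
    measurable_pi_lambda _ fun j => (measurable_pi_apply _).sub (measurable_pi_apply _)

lemma indepFun_incr (hR : IsRealization P r N V) {s u : ℝ≥0} (hsu : s ≤ u) {e e' : Event m k}
    (he : e ≠ e') : IndepFun (fun ω => incr N s u ω e) (fun ω => incr N s u ω e') P := by
  -- The time sequence `s, u, u, ...` has the increment over `(s, u]` at index `0`.
  have := hR.iIndepFun_incr (τ := fun j => if j = 0 then s else u) (by
    intro i j hij
    dsimp only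
    split_ifs with h1 h2 h2
    · exact le_rfl
    · exact hsu
    · omega
    · exact le_rfl)
  simpa using this.indepFun (i := (e, 0)) (j := (e', 0)) (by simpa using he)

lemma integrable_incr_mul (hR : IsRealization P r N V) {s u : ℝ≥0} (hsu : s ≤ u)
    (e e' : Event m k) : Integrable (fun ω => (incr N s u ω e : ℝ) * incr N s u ω e') P := by
  by_cases he : e = e'
  · subst he
    simpa [sq] using hR.integrable_incr_sq hsu e
  · exact ((hR.indepFun_incr hsu he).comp (φ := fun n : ℕ => (n : ℝ)) (ψ := fun n : ℕ => (n : ℝ))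
      .of_discrete .of_discrete).integrable_mul (hR.integrable_incr hsu e)
      (hR.integrable_incr hsu e')

lemma integral_incr_mul [DecidableEq (Event m k)] (hR : IsRealization P r N V) {s u : ℝ≥0}
    (hsu : s ≤ u) (e e' : Event m k) :
    ∫ ω, (incr N s u ω e : ℝ) * incr N s u ω e' ∂P =
      (e.rate r * ((u : ℝ) - s)) * (e'.rate r * ((u : ℝ) - s)) +
        if e = e' then e.rate r * ((u : ℝ) - s) else 0 := by
  split_ifs with he
  · subst he
    simpa [sq] using hR.integral_incr_sq hsu e
  · rw [add_zero, (hR.indepFun_incr hsu he).integral_fun_comp_mul_comp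
      (f := fun n : ℕ => (n : ℝ)) (g := fun n : ℕ => (n : ℝ))
      (hR.measurable_incr s u e).aemeasurable (hR.measurable_incr s u e').aemeasurable
      .of_discrete .of_discrete, hR.integral_incr hsu, hR.integral_incr hsu]

lemma measurable_V (hR : IsRealization P r N V) (t : ℝ≥0) : Measurable (V t) :=
  measurable_pi_lambda _ fun v => hR.measurable t v

lemma measurable_incr' (hR : IsRealization P r N V) (s u : ℝ≥0) : Measurable (incr N s u) :=
  measurable_pi_lambda _ fun e => hR.measurable_incr s u e

section Finite

variable [NeZero m] [NeZero k]

lemma V_eq_step (hR : IsRealization P r N V) {s u : ℝ≥0} (hsu : s ≤ u) {ω : Ω}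
    (h : ∑ e, incr N s u ω e ≤ 1) : V u ω = step (incr N s u ω) (V s ω) := by
  have key : ∀ e, N e u ω = N e s ω + incr N s u ω e := fun e => by
    have := (hR.poisson e).mono ω hsu
    simp only [incr] at *
    omega
  unfold step
  split_ifs with he
  · obtain ⟨h1, h2⟩ := he.choose_spec
    refine hR.act_of_single_event ω s u _ hsu ?_ fun e' he' => ?_
    · rw [key, h1]
    · rw [key, h2 e' he', add_zero]
  · refine hR.const_of_no_event ω s u hsu fun e => ?_
    rw [key, (eq_zero_or_single_of_sum_le_one h).resolve_right he e, add_zero]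

lemma integrable_pairs (hR : IsRealization P r N V) {s u : ℝ≥0} (hsu : s ≤ u) :
    Integrable (fun ω => pairs (incr N s u ω)) P := by
  simp only [pairs, sq, Finset.sum_mul_sum]
  exact (integrable_finsetSum _ fun e _ => integrable_finsetSum _ fun e' _ =>
    hR.integrable_incr_mul hsu e e').sub (integrable_finsetSum _ fun e _ =>
      hR.integrable_incr hsu e)

/-- The variance of a Poisson variable equals its mean, so the diagonal terms of the squared sum
cancel against the subtracted sum. What is left is quadratic in the length of the interval. -/
lemma integral_pairs (hR : IsRealization P r N V) {s u : ℝ≥0} (hsu : s ≤ u) :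
    ∫ ω, pairs (incr N s u ω) ∂P = (totalRate m k r * ((u : ℝ) - s)) ^ 2 := by
  classical
  simp only [pairs, sq, Finset.sum_mul_sum]
  rw [integral_sub (integrable_finsetSum _ fun e _ => integrable_finsetSum _ fun e' _ =>
    hR.integrable_incr_mul hsu e e') (integrable_finsetSum _ fun e _ =>
      hR.integrable_incr hsu e), integral_finsetSum _ (fun e _ => integrable_finsetSum _
      fun e' _ => hR.integrable_incr_mul hsu e e'), integral_finsetSum _ fun e _ =>
      hR.integrable_incr hsu e]
  simp_rw [integral_finsetSum _ fun e' _ => hR.integrable_incr_mul hsu _ e',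
    hR.integral_incr_mul hsu, hR.integral_incr hsu, Finset.sum_add_distrib]
  rw [← Finset.sum_mul_sum, ← Finset.sum_mul, totalRate]
  simp [Finset.sum_mul]

end Finite

end IsRealization

variable [NeZero m] [NeZero k]

lemma pairs_nonneg (J : Event m k → ℕ) : 0 ≤ pairs J := by
  have h : pairs J = ((∑ e, J e : ℕ) : ℝ) ^ 2 - ((∑ e, J e : ℕ) : ℝ) := by simp [pairs]
  rw [h, sub_nonneg]
  exact_mod_cast Nat.le_self_pow two_ne_zero _

lemma sum_le_pairs {J : Event m k → ℕ} (hJ : 2 ≤ ∑ e, J e) : ∑ e, (J e : ℝ) ≤ pairs J := by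
  have h : (2 : ℝ) ≤ ∑ e, (J e : ℝ) := by exact_mod_cast hJ
  rw [pairs]
  nlinarith

namespace IsRealization

lemma measureReal_two_le_incr [IsProbabilityMeasure P] (hR : IsRealization P r N V) {s u : ℝ≥0}
    (hsu : s ≤ u) :
    P.real {ω | 2 ≤ ∑ e, incr N s u ω e} ≤ (totalRate m k r * ((u : ℝ) - s)) ^ 2 := by
  rw [← hR.integral_pairs hsu]
  have := mul_meas_ge_le_integral_of_nonneg (.of_forall fun ω => pairs_nonneg (incr N s u ω))
    (hR.integrable_pairs hsu) 1
  rw [one_mul] at this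
  refine (measureReal_mono fun ω (hω : 2 ≤ ∑ e, incr N s u ω e) => ?_).trans this
  have h1 := sum_le_pairs hω
  have h2 : (2 : ℝ) ≤ ∑ e, (incr N s u ω e : ℝ) := by exact_mod_cast hω
  exact (by linarith : (1 : ℝ) ≤ pairs (incr N s u ω))

/-- There are `n` cells of length `t / n`, each crowded with probability quadratic in its length.
The extra cell that ends at `t + h` is not counted. -/
lemma measureReal_crowded_le [IsProbabilityMeasure P] (hR : IsRealization P r N V) (t h : ℝ≥0)
    {n : ℕ} (hn : 0 < n) :
    P.real (crowded N t h n) ≤ (totalRate m k r * t) ^ 2 / n := by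
  refine (measureReal_biUnion_finset_le _ _).trans ?_
  calc _ ≤ ∑ j ∈ Finset.range n, (totalRate m k r * (t / n)) ^ 2 := by
        refine Finset.sum_le_sum fun j hj => ?_
        rw [← gridTime_sub t h (Finset.mem_range.1 hj)]
        exact hR.measureReal_two_le_incr (gridTime_mono t h hn j.le_succ)
    _ = _ := by
        have : (n : ℝ) ≠ 0 := by positivity
        simp only [Finset.sum_const, Finset.card_range, nsmul_eq_mul]
        field_simp

lemma tendsto_measureReal_crowded [IsProbabilityMeasure P] (hR : IsRealization P r N V)
    (t h : ℝ≥0) : Tendsto (fun n => P.real (crowded N t h n)) atTop (𝓝 0) := by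
  refine squeeze_zero' (.of_forall fun n => measureReal_nonneg) ?_
    (tendsto_const_div_atTop_nhds_zero_nat ((totalRate m k r * t) ^ 2))
  filter_upwards [eventually_gt_atTop 0] with n hn using hR.measureReal_crowded_le t h hn

lemma eq_gridChain (hR : IsRealization P r N V) {t h : ℝ≥0} {n : ℕ} (hn : 0 < n) {ω : Ω}
    (hω : ω ∉ crowded N t h n) {j : ℕ} (hj : j ≤ n) :
    V (gridTime t h n j) ω = gridChain N t h n (V 0 ω) ω j := by
  simp only [crowded, Set.mem_iUnion, not_exists, Finset.mem_range, Set.mem_ofPred_eq,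
    not_le] at hω
  induction j with
  | zero => rw [gridTime_zero]; rfl
  | succ j ih =>
    rw [hR.V_eq_step (gridTime_mono t h hn j.le_succ) (Nat.le_of_lt_succ (hω j hj)),
      ih (by omega)]
    rfl

lemma ordered_and_source_of_not_crowded (hR : IsRealization P r N V) {t h : ℝ≥0} {n : ℕ}
    (hn : 0 < n) {ω : Ω} (hω : ω ∉ crowded N t h n) {j : ℕ} (hj : j ≤ n) :
    Ordered (V (gridTime t h n j) ω) ∧
      V (gridTime t h n j) ω .source =
        V 0 ω .source + N .newVersion (gridTime t h n j) ω := by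
  have hω' := hω
  simp only [crowded, Set.mem_iUnion, not_exists, Finset.mem_range, Set.mem_ofPred_eq,
    not_le] at hω'
  induction j with
  | zero =>
    obtain ⟨V₀, h0, h1⟩ := hR.initial
    rw [gridTime_zero, h0 ω, (hR.poisson _).zero]
    exact ⟨h1, rfl⟩
  | succ j ih =>
    obtain ⟨ih1, ih2⟩ := ih (by omega)
    have hle : gridTime t h n j ≤ gridTime t h n (j + 1) := gridTime_mono t h hn j.le_succ
    have h1 := Nat.le_of_lt_succ (hω' j hj)
    rw [hR.V_eq_step hle h1]
    refine ⟨ih1.step _, ?_⟩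
    rw [step_source h1, ih2]
    have := (hR.poisson .newVersion).mono ω hle
    simp only [incr] at *
    omega

/-- Only an almost sure statement is possible, since the axioms say nothing about simultaneous
events. The exceptional set lies in `crowded` for every grid. -/
lemma ae_ordered_and_source [IsProbabilityMeasure P] (hR : IsRealization P r N V) (t : ℝ≥0) :
    ∀ᵐ ω ∂P, Ordered (V t ω) ∧ V t ω .source = V 0 ω .source + N .newVersion t ω := by
  rw [ae_iff, ← measureReal_eq_zero_iff]
  refine le_antisymm (ge_of_tendsto (hR.tendsto_measureReal_crowded t 0) ?_) measureReal_nonneg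
  filter_upwards [eventually_gt_atTop 0] with n hn
  refine measureReal_mono fun ω hω => ?_
  by_contra h
  have := hR.ordered_and_source_of_not_crowded hn h le_rfl
  rw [gridTime_self t 0 hn] at this
  exact hω this

/-- Appending `t + h` to the grid puts past and future increments into one independent family; the
chain and the future increment use disjoint index sets. -/
lemma indepFun_gridChain (hR : IsRealization P r N V) (t h : ℝ≥0) {n : ℕ} (hn : 0 < n)
    (x : Vertex m k → ℕ) :
    IndepFun (fun ω => gridChain N t h n x ω n) (fun ω => incr N t (t + h) ω) P := by
  classical
  have h1 := (hR.iIndepFun_incr (gridTime_mono t h hn)).indepFun_finset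
    (Finset.univ ×ˢ Finset.range n) (Finset.univ ×ˢ {n}) (by
      rw [Finset.disjoint_left]
      rintro ⟨e, j⟩ h1 h2
      simp at h1 h2
      omega) fun p => hR.measurable_incr _ _ p.1
  let φ : (↥(Finset.univ ×ˢ Finset.range n : Finset (Event m k × ℕ)) → ℕ) → Vertex m k → ℕ :=
    fun f => chain (fun j e => if hj : j < n then f ⟨(e, j), by simpa using hj⟩ else 0) x n
  let ψ : (↥(Finset.univ ×ˢ {n} : Finset (Event m k × ℕ)) → ℕ) → Event m k → ℕ :=
    fun f e => f ⟨(e, n), by simp⟩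
  have e1 : (fun ω => gridChain N t h n x ω n) = φ ∘ fun ω p =>
      incr N (gridTime t h n p.1.2) (gridTime t h n (p.1.2 + 1)) ω p.1.1 := by
    funext ω
    refine chain_congr x fun j hj => ?_
    funext e
    simp [hj]
  have e2 : (fun ω => incr N t (t + h) ω) = ψ ∘ fun ω p =>
      incr N (gridTime t h n p.1.2) (gridTime t h n (p.1.2 + 1)) ω p.1.1 := by
    funext ω e
    simp [ψ, gridTime_self t h hn, gridTime_succ_self]
  rw [e1, e2]
  exact h1.comp (measurable_of_countable φ) (measurable_of_countable ψ)

lemma indepFun_V_incr [IsProbabilityMeasure P] (hR : IsRealization P r N V) (t h : ℝ≥0) :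
    IndepFun (V t) (incr N t (t + h)) P := by
  obtain ⟨V₀, h0, -⟩ := hR.initial
  rw [indepFun_iff_measure_inter_preimage_eq_mul]
  intro A B hA hB
  rw [← ENNReal.toReal_eq_toReal_iff' (by simp) (by finiteness), ENNReal.toReal_mul]
  change P.real _ = P.real _ * P.real _
  rw [← sub_eq_zero, ← abs_nonpos_iff]
  have h2 : Tendsto (fun n => 2 * P.real (crowded N t h n)) atTop (𝓝 0) := by
    simpa using (hR.tendsto_measureReal_crowded t h).const_mul 2
  refine ge_of_tendsto h2 ?_
  filter_upwards [eventually_gt_atTop 0] with n hn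
  set W := fun ω => gridChain N t h n V₀ ω n with hW
  set I := incr N t (t + h) ⁻¹' B
  set b := crowded N t h n
  have hVW : ∀ ω, ω ∉ b → V t ω = W ω := fun ω hω => by
    have := hR.eq_gridChain hn hω le_rfl
    rwa [gridTime_self t h hn, h0 ω] at this
  have hind : P.real (W ⁻¹' A ∩ I) = P.real (W ⁻¹' A) * P.real I := by
    have := (hR.indepFun_gridChain t h hn V₀).measure_inter_preimage_eq_mul A B hA hB
    simp only [Measure.real, ← ENNReal.toReal_mul]
    exact congrArg _ this
  have hle : ∀ S T : Set Ω, S ⊆ T ∪ b → P.real S ≤ P.real T + P.real b := fun S T h =>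
    (measureReal_mono h).trans (measureReal_union_le _ _)
  -- Off `b` the states `V t` and `W` agree, so replacing one by the other costs at most `P.real b`
  -- in each of the two probabilities; hence the bound `2 * P.real b`.
  have e1 := hle (V t ⁻¹' A ∩ I) (W ⁻¹' A ∩ I) (by
    rintro ω ⟨h1, h2⟩
    by_cases hω : ω ∈ b
    · exact .inr hω
    · exact .inl ⟨by simpa [← hVW ω hω] using h1, h2⟩)
  have e2 := hle (W ⁻¹' A ∩ I) (V t ⁻¹' A ∩ I) (by
    rintro ω ⟨h1, h2⟩
    by_cases hω : ω ∈ b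
    · exact .inr hω
    · exact .inl ⟨by simpa [hVW ω hω] using h1, h2⟩)
  have e3 := hle (V t ⁻¹' A) (W ⁻¹' A) (by
    intro ω h1
    by_cases hω : ω ∈ b
    · exact .inr hω
    · exact .inl (by simpa [← hVW ω hω] using h1))
  have e4 := hle (W ⁻¹' A) (V t ⁻¹' A) (by
    intro ω h1
    by_cases hω : ω ∈ b
    · exact .inr hω
    · exact .inl (by simpa [hVW ω hω] using h1))
  have hI : P.real I ≤ 1 := measureReal_le_one
  have hI0 : 0 ≤ P.real I := measureReal_nonneg
  have hb0 : 0 ≤ P.real b := measureReal_nonneg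
  rw [abs_le]
  constructor <;> nlinarith

end IsRealization

end

/-! ### Scalar linear differential equations with one-sided derivatives. -/

section

lemma limsup_le_of_linear_ode {y g : ℝ → ℝ} {a L ε : ℝ} (ha : 0 < a) (hε : 0 < ε)
    (hc : ContinuousOn y (Set.Ici 0))
    (hd : ∀ t, 0 ≤ t → HasDerivWithinAt y (g t - a * y t) (Set.Ici t) t)
    (hg : Tendsto g atTop (𝓝 L)) : ∀ᶠ t in atTop, y t < L / a + ε := by
  have h1 : ∀ᶠ t in atTop, g t < L + a * (ε / 2) :=
    hg.eventually_lt_const (by have := mul_pos ha hε; linarith)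
  obtain ⟨T, hT0, hT⟩ : ∃ T, 0 ≤ T ∧ ∀ t, T ≤ t → g t < L + a * (ε / 2) := by
    obtain ⟨T, hT⟩ := eventually_atTop.1 h1
    exact ⟨max T 0, le_max_right _ _, fun t ht => hT t ((le_max_left _ _).trans ht)⟩
  set B := L / a + ε / 2 with hB
  have haB : a * B = L + a * (ε / 2) := by rw [hB]; field_simp
  have hexp : ∀ t : ℝ, HasDerivAt (fun t => Real.exp (a * t)) (a * Real.exp (a * t)) t := fun t => by
    simpa [mul_comm] using ((hasDerivAt_id t).const_mul a).exp
  -- With the integrating factor `exp (a t)`, the derivative of the left side is `exp (a t) * g t`,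
  -- which from `T` on is at most that of `B * exp (a t)`.
  have key : ∀ t, T ≤ t → Real.exp (a * t) * y t ≤
      B * Real.exp (a * t) + (Real.exp (a * T) * y T - B * Real.exp (a * T)) := by
    intro t ht
    refine image_le_of_deriv_right_le_deriv_boundary (a := T) (b := t)
      (f := fun t => Real.exp (a * t) * y t)
      (f' := fun t => a * Real.exp (a * t) * y t + Real.exp (a * t) * (g t - a * y t))
      (B := fun t => B * Real.exp (a * t) + (Real.exp (a * T) * y T - B * Real.exp (a * T)))
      (B' := fun t => B * (a * Real.exp (a * t))) ?_ ?_ ?_ ?_ ?_ ?_ ⟨ht, le_rfl⟩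
    · exact ContinuousOn.mul (by fun_prop) (hc.mono fun x hx => hT0.trans hx.1)
    · exact fun x hx => (hexp x).hasDerivWithinAt.mul (hd x (hT0.trans hx.1))
    · exact le_of_eq (by ring)
    · fun_prop
    · exact fun x _ => (((hexp x).const_mul B).add_const _).hasDerivWithinAt
    · intro x hx
      have := (hT x hx.1).le
      have h2 := Real.exp_pos (a * x)
      calc _ = Real.exp (a * x) * g x := by ring
        _ ≤ Real.exp (a * x) * (a * B) := by rw [haB]; gcongr
        _ = _ := by ring
  set c := Real.exp (a * T) * y T - B * Real.exp (a * T)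
  have h3 : Tendsto (fun t => c * Real.exp (-(a * t))) atTop (𝓝 0) := by
    have : Tendsto (fun t : ℝ => a * t) atTop atTop := tendsto_id.const_mul_atTop ha
    simpa using (Real.tendsto_exp_neg_atTop_nhds_zero.comp this).const_mul c
  filter_upwards [h3.eventually_lt_const (half_pos hε), eventually_ge_atTop T] with t h4 ht
  have h5 := key t ht
  have h6 := Real.exp_pos (a * t)
  rw [Real.exp_neg] at h4
  have h7 : y t ≤ B + c * (Real.exp (a * t))⁻¹ := by
    rw [← mul_le_mul_iff_right₀ h6]
    refine h5.trans (le_of_eq ?_)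
    field_simp
  linarith

/-- The solution of a stable linear differential equation `y' = g - a y` whose inhomogeneity
converges to `L` converges to `L / a`. -/
lemma tendsto_of_linear_ode {y g : ℝ → ℝ} {a L : ℝ} (ha : 0 < a)
    (hc : ContinuousOn y (Set.Ici 0))
    (hd : ∀ t, 0 ≤ t → HasDerivWithinAt y (g t - a * y t) (Set.Ici t) t)
    (hg : Tendsto g atTop (𝓝 L)) : Tendsto y atTop (𝓝 (L / a)) := by
  rw [Metric.tendsto_nhds]
  intro ε hε
  have h1 := limsup_le_of_linear_ode ha hε hc hd hg
  have h2 := limsup_le_of_linear_ode (y := fun t => -y t) (g := fun t => -g t) ha hε hc.neg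
    (fun t ht => by
      convert! (hd t ht).neg using 1
      ring) hg.neg
  filter_upwards [h1, h2] with t h1 h2
  rw [Real.dist_eq, abs_lt]
  rw [neg_div] at h2
  constructor <;> linarith

lemma hasDerivWithinAt_of_abs_sub_le {F : ℝ → ℝ} {t D K : ℝ}
    (h : ∀ δ, 0 ≤ δ → |F (t + δ) - F t - δ * D| ≤ K * δ ^ 2) :
    HasDerivWithinAt F D (Set.Ici t) t := by
  rw [hasDerivWithinAt_iff_isLittleO]
  have h1 : (fun s => ‖s - t‖ ^ 2) =o[𝓝[Set.Ici t] t] fun s => s - t :=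
    (Asymptotics.isLittleO_pow_sub_sub t one_lt_two).mono nhdsWithin_le_nhds
  refine Asymptotics.IsBigO.trans_isLittleO (Asymptotics.IsBigO.of_bound K ?_) h1
  filter_upwards [self_mem_nhdsWithin] with s (hs : t ≤ s)
  have := h (s - t) (by linarith)
  rw [add_sub_cancel] at this
  simpa [abs_of_nonneg (sub_nonneg.2 hs)] using this

/-- A right derivative alone does not give continuity from the left; locally uniform constants in
the forward expansion make `F` Lipschitz on bounded intervals. -/
lemma continuousOn_of_abs_sub_le {F D B K : ℝ → ℝ} (hB : Monotone B) (hK : Monotone K)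
    (hD : ∀ t, 0 ≤ t → |D t| ≤ B t) (hK0 : ∀ t, 0 ≤ t → 0 ≤ K t)
    (h : ∀ t δ, 0 ≤ t → 0 ≤ δ → |F (t + δ) - F t - δ * D t| ≤ K t * δ ^ 2) :
    ContinuousOn F (Set.Ici 0) := by
  have key : ∀ T s u, 0 ≤ s → s ≤ u → u ≤ T → |F u - F s| ≤ (B T + K T * T) * (u - s) := by
    intro T s u hs hsu huT
    have h1 := h s (u - s) hs (by linarith)
    rw [add_sub_cancel] at h1
    have h2 : |(u - s) * D s| ≤ (u - s) * B T := by
      rw [abs_mul, abs_of_nonneg (by linarith)]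
      exact mul_le_mul_of_nonneg_left ((hD s hs).trans (hB (hsu.trans huT))) (by linarith)
    have h3 : K s * (u - s) ^ 2 ≤ K T * T * (u - s) := by
      rw [sq, ← mul_assoc]
      have : K s ≤ K T := hK (hsu.trans huT)
      have := hK0 s hs
      have := hK0 T (by linarith)
      gcongr
      linarith
    have h4 := abs_add_le (F u - F s - (u - s) * D s) ((u - s) * D s)
    rw [sub_add_cancel] at h4
    linarith
  intro t ht
  have hC : 0 ≤ B (t + 1) + K (t + 1) * (t + 1) := by
    have ht' : (0 : ℝ) ≤ t + 1 := by linarith [Set.mem_Ici.1 ht]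
    have := (abs_nonneg _).trans (hD _ ht')
    have := hK0 _ ht'
    positivity
  have hL : LipschitzOnWith (B (t + 1) + K (t + 1) * (t + 1)).toNNReal F (Set.Icc 0 (t + 1)) := by
    refine LipschitzOnWith.of_dist_le_mul fun x hx y hy => ?_
    rw [Real.coe_toNNReal _ hC, Real.dist_eq, Real.dist_eq]
    rcases le_total x y with hxy | hxy
    · rw [abs_sub_comm, abs_sub_comm x, abs_of_nonneg (sub_nonneg.2 hxy)]
      exact key _ x y hx.1 hxy hy.2
    · rw [abs_of_nonneg (sub_nonneg.2 hxy)]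
      exact key _ y x hy.1 hxy hx.2
  refine (hL.continuousOn t ⟨ht, by linarith⟩).mono_of_mem_nhdsWithin ?_
  rw [mem_nhdsWithin]
  exact ⟨Set.Iio (t + 1), isOpen_Iio, by simp, fun x hx => ⟨hx.2, hx.1.le⟩⟩

/-! ### The differential equation for mean set ages. -/

variable {m k : ℕ} [NeZero m] [NeZero k]

lemma setAge_step {J : Event m k → ℕ} (hJ : ∑ e, J e ≤ 1) (x : Vertex m k → ℕ)
    (S : Finset (Vertex m k)) :
    setAge S (step J x) - setAge S x = ∑ e, (J e : ℝ) * (setAge S (e.act x) - setAge S x) := by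
  unfold step
  split_ifs with h
  · obtain ⟨h1, h2⟩ := h.choose_spec
    rw [Finset.sum_eq_single h.choose (fun e _ he => by simp [h2 e he]) (by simp), h1]
    simp
  · rw [Finset.sum_eq_zero, sub_self]
    intro e _
    rw [(eq_zero_or_single_of_sum_le_one hJ).resolve_right h e]
    simp

omit [NeZero m] [NeZero k] in
lemma Ordered.abs_setAge_act_sub_le {x : Vertex m k → ℕ} (hx : Ordered x) (e : Event m k)
    (S : Finset (Vertex m k)) : |setAge S (e.act x) - setAge S x| ≤ x .source + 1 := by
  classical
  have h1 := (hx.act e).setAge_nonneg S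
  have h2 := hx.setAge_nonneg S
  have h3 := setAge_le S (e.act x)
  have h4 := setAge_le S x
  have h5 : ((e.act x .source : ℕ) : ℝ) ≤ x .source + 1 := by
    rw [act_source]
    split_ifs <;> simp
  rw [abs_le]
  constructor <;> linarith

lemma abs_setAge_sub_le {x y : Vertex m k → ℕ} (hx : Ordered x) (hy : Ordered y)
    {J : Event m k → ℕ} (hJ : ∑ e, J e ≤ 1 → y = step J x)
    (hsrc : y .source = x .source + J .newVersion) (S : Finset (Vertex m k)) :
    |setAge S y - setAge S x - ∑ e, (J e : ℝ) * (setAge S (e.act x) - setAge S x)| ≤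
      2 * (pairs J * (x .source + 1)) := by
  rcases le_or_gt (∑ e, J e) 1 with h | h
  · rw [hJ h, setAge_step h, sub_self, abs_zero]
    have := pairs_nonneg J
    positivity
  · have h1 : ∑ e, (J e : ℝ) ≤ pairs J := sum_le_pairs h
    have h0 : (2 : ℝ) ≤ ∑ e, (J e : ℝ) := by exact_mod_cast h
    have h2 : (J .newVersion : ℝ) ≤ ∑ e, (J e : ℝ) :=
      Finset.single_le_sum (f := fun e => (J e : ℝ)) (fun e _ => by positivity)
        (Finset.mem_univ _)
    have h3 : |∑ e, (J e : ℝ) * (setAge S (e.act x) - setAge S x)| ≤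
        (∑ e, (J e : ℝ)) * (x .source + 1) := by
      rw [Finset.sum_mul]
      refine (Finset.abs_sum_le_sum_abs _ _).trans (Finset.sum_le_sum fun e _ => ?_)
      rw [abs_mul, Nat.abs_cast]
      exact mul_le_mul_of_nonneg_left (hx.abs_setAge_act_sub_le e S) (by positivity)
    have h4 : |setAge S y - setAge S x| ≤ x .source + ∑ e, (J e : ℝ) := by
      have a1 := hy.setAge_nonneg S
      have a2 := hx.setAge_nonneg S
      have a3 := setAge_le S y
      have a4 := setAge_le S x
      rw [hsrc] at a3
      push_cast at a3
      rw [abs_le]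
      constructor <;> linarith
    have h5 := abs_sub (setAge S y - setAge S x)
      (∑ e, (J e : ℝ) * (setAge S (e.act x) - setAge S x))
    have h6 : (0 : ℝ) ≤ x .source := by positivity
    -- With `M = ∑ e, J e ≥ 2`, both `x .source + M` and the bound in `h3` are at most `M * (x
    -- .source + 1)`, and `M ≤ pairs J`; this gives the factor `2`.
    nlinarith

variable {Ω : Type*} [MeasurableSpace Ω] {P : Measure Ω} {r : Rates}
  {N : Event m k → ℝ≥0 → Ω → ℕ} {V : ℝ≥0 → Ω → Vertex m k → ℕ}

/-- The expected version age of a set of vertices. -/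
noncomputable def meanAge (P : Measure Ω) (V : ℝ≥0 → Ω → Vertex m k → ℕ)
    (S : Finset (Vertex m k)) (t : ℝ≥0) : ℝ :=
  ∫ ω, setAge S (V t ω) ∂P

/-- The expected instantaneous rate of change of the version age of a set of vertices. -/
noncomputable def drift (P : Measure Ω) (r : Rates) (V : ℝ≥0 → Ω → Vertex m k → ℕ)
    (S : Finset (Vertex m k)) (t : ℝ≥0) : ℝ :=
  ∑ e : Event m k, (e.rate r : ℝ) * ∫ ω, (setAge S (e.act (V t ω)) - setAge S (V t ω)) ∂P

namespace IsRealization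

variable [IsProbabilityMeasure P]

lemma ae_source_eq (hR : IsRealization P r N V) : ∃ v : ℕ, ∀ t, ∀ᵐ ω ∂P,
    V t ω .source = v + incr N 0 t ω .newVersion := by
  obtain ⟨V₀, h0, -⟩ := hR.initial
  refine ⟨V₀ .source, fun t => ?_⟩
  filter_upwards [hR.ae_ordered_and_source t] with ω hω
  rw [hω.2, h0, incr, (hR.poisson _).zero, Nat.sub_zero]

lemma integrable_source (hR : IsRealization P r N V) (t : ℝ≥0) :
    Integrable (fun ω => (V t ω .source : ℝ)) P := by
  obtain ⟨v, hv⟩ := hR.ae_source_eq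
  refine ((integrable_const (v : ℝ)).add
    (hR.integrable_incr (zero_le : 0 ≤ t) .newVersion)).congr ?_
  filter_upwards [hv t] with ω hω
  simp [hω]

lemma integral_source (hR : IsRealization P r N V) : ∃ v : ℝ, 0 ≤ v ∧ ∀ t : ℝ≥0,
    ∫ ω, (V t ω .source : ℝ) ∂P = v + r.lamE * t := by
  obtain ⟨v, hv⟩ := hR.ae_source_eq
  refine ⟨v, by positivity, fun t => ?_⟩
  have : (fun ω => (V t ω .source : ℝ)) =ᵐ[P]
      fun ω => (v : ℝ) + (incr N 0 t ω .newVersion : ℝ) := by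
    filter_upwards [hv t] with ω hω
    simp [hω]
  rw [integral_congr_ae this, integral_add (integrable_const _)
    (hR.integrable_incr (zero_le : 0 ≤ t) _), hR.integral_incr (zero_le : 0 ≤ t)]
  simp [Event.rate]

lemma integrable_comp (hR : IsRealization P r N V) (t : ℝ≥0) (f : (Vertex m k → ℕ) → ℝ)
    (hf : ∀ x, Ordered x → |f x| ≤ x .source + 1) : Integrable (fun ω => f (V t ω)) P := by
  refine ((hR.integrable_source t).add (integrable_const 1)).mono'
    ((measurable_of_countable f).comp (hR.measurable_V t)).aestronglyMeasurable ?_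
  filter_upwards [hR.ae_ordered_and_source t] with ω hω using hf _ hω.1

lemma integrable_setAge (hR : IsRealization P r N V) (S : Finset (Vertex m k)) (t : ℝ≥0) :
    Integrable (fun ω => setAge S (V t ω)) P := by
  refine hR.integrable_comp t _ fun x hx => ?_
  rw [abs_of_nonneg (hx.setAge_nonneg S)]
  linarith [setAge_le S x]

lemma integrable_setAge_act_sub (hR : IsRealization P r N V) (S : Finset (Vertex m k)) (t : ℝ≥0)
    (e : Event m k) : Integrable (fun ω => setAge S (e.act (V t ω)) - setAge S (V t ω)) P :=
  hR.integrable_comp t (fun x => setAge S (e.act x) - setAge S x)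
    fun _ hx => hx.abs_setAge_act_sub_le e S

lemma abs_drift_le (hR : IsRealization P r N V) (S : Finset (Vertex m k)) (t : ℝ≥0) :
    |drift P r V S t| ≤ totalRate m k r * (∫ ω, (V t ω .source : ℝ) ∂P + 1) := by
  rw [drift, totalRate, Finset.sum_mul]
  refine (Finset.abs_sum_le_sum_abs _ _).trans (Finset.sum_le_sum fun e _ => ?_)
  rw [abs_mul, NNReal.abs_eq]
  refine mul_le_mul_of_nonneg_left ?_ (by positivity)
  have h1 : ∫ ω, (V t ω .source : ℝ) ∂P + 1 = ∫ ω, ((V t ω .source : ℝ) + 1) ∂P := by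
    rw [integral_add (hR.integrable_source t) (integrable_const _)]
    simp
  rw [h1]
  rw [← Real.norm_eq_abs]
  refine norm_integral_le_of_norm_le ((hR.integrable_source t).add (integrable_const 1)) ?_
  filter_upwards [hR.ae_ordered_and_source t] with ω hω using hω.1.abs_setAge_act_sub_le e S

/-- Independence of `V t` and the increments over `(t, t + h]` factorizes both expectations: the
main term becomes `h` times the drift, and the error contains the mean of `pairs`, which is of order
`h²`. -/
lemma abs_meanAge_sub_le (hR : IsRealization P r N V) (S : Finset (Vertex m k)) (t h : ℝ≥0) :
    |meanAge P V S (t + h) - meanAge P V S t - h * drift P r V S t| ≤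
      2 * totalRate m k r ^ 2 * (∫ ω, (V t ω .source : ℝ) ∂P + 1) * (h : ℝ) ^ 2 := by
  have hle : t ≤ t + h := le_self_add
  have hind := hR.indepFun_V_incr t h
  have hVm := (hR.measurable_V t).aemeasurable (μ := P)
  have hIm := (hR.measurable_incr' t (t + h)).aemeasurable (μ := P)
  have hprod : ∀ e : Event m k, Integrable (fun ω => (incr N t (t + h) ω e : ℝ) *
      (setAge S (e.act (V t ω)) - setAge S (V t ω))) P := fun e =>
    (hind.symm.comp (φ := fun J : Event m k → ℕ => (J e : ℝ))
      (ψ := fun x => setAge S (e.act x) - setAge S x) (measurable_of_countable _)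
      (measurable_of_countable _)).integrable_mul (hR.integrable_incr hle e)
      (hR.integrable_setAge_act_sub S t e)
  have hprodi : ∀ e : Event m k, ∫ ω, (incr N t (t + h) ω e : ℝ) *
      (setAge S (e.act (V t ω)) - setAge S (V t ω)) ∂P =
      h * (e.rate r * ∫ ω, (setAge S (e.act (V t ω)) - setAge S (V t ω)) ∂P) := fun e => by
    rw [hind.symm.integral_fun_comp_mul_comp (f := fun J : Event m k → ℕ => (J e : ℝ))
      (g := fun x => setAge S (e.act x) - setAge S x) hIm hVm
      (measurable_of_countable _).aestronglyMeasurable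
      (measurable_of_countable _).aestronglyMeasurable, hR.integral_incr hle]
    push_cast
    ring
  have hsrc : Integrable (fun ω => (V t ω .source : ℝ) + 1) P :=
    (hR.integrable_source t).add (integrable_const 1)
  have hboundint : Integrable (fun ω => pairs (incr N t (t + h) ω) *
      ((V t ω .source : ℝ) + 1)) P :=
    (hind.symm.comp (φ := fun J => pairs J) (ψ := fun x : Vertex m k → ℕ => (x .source : ℝ) + 1)
      (measurable_of_countable _) (measurable_of_countable _)).integrable_mul
      (hR.integrable_pairs hle) hsrc
  have hbound : ∫ ω, 2 * (pairs (incr N t (t + h) ω) * ((V t ω .source : ℝ) + 1)) ∂P =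
      2 * totalRate m k r ^ 2 * (∫ ω, (V t ω .source : ℝ) ∂P + 1) * (h : ℝ) ^ 2 := by
    rw [integral_const_mul, hind.symm.integral_fun_comp_mul_comp (f := fun J => pairs J)
      (g := fun x : Vertex m k → ℕ => (x .source : ℝ) + 1) hIm hVm
      (measurable_of_countable _).aestronglyMeasurable
      (measurable_of_countable _).aestronglyMeasurable, hR.integral_pairs hle,
      integral_add (hR.integrable_source t) (integrable_const _)]
    simp
    ring
  have heq : meanAge P V S (t + h) - meanAge P V S t - h * drift P r V S t =
      ∫ ω, (setAge S (V (t + h) ω) - setAge S (V t ω) -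
        ∑ e, (incr N t (t + h) ω e : ℝ) *
          (setAge S (e.act (V t ω)) - setAge S (V t ω))) ∂P := by
    have hdiff : Integrable (fun ω => setAge S (V (t + h) ω) - setAge S (V t ω)) P :=
      (hR.integrable_setAge S _).sub (hR.integrable_setAge S _)
    rw [integral_sub hdiff
      (integrable_finsetSum _ fun e _ => hprod e), integral_sub (hR.integrable_setAge S _)
      (hR.integrable_setAge S _), integral_finsetSum _ fun e _ => hprod e]
    simp_rw [hprodi]
    rw [← Finset.mul_sum]
    rfl
  rw [heq, ← hbound]
  rw [← Real.norm_eq_abs]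
  refine norm_integral_le_of_norm_le (hboundint.const_mul 2) ?_
  filter_upwards [hR.ae_ordered_and_source t, hR.ae_ordered_and_source (t + h)] with ω h1 h2
  refine abs_setAge_sub_le h1.1 h2.1 (fun hJ => hR.V_eq_step hle hJ) ?_ S
  rw [h1.2, h2.2]
  have := (hR.poisson .newVersion).mono ω hle
  simp only [incr] at *
  omega

lemma hasDerivWithinAt_meanAge (hR : IsRealization P r N V) (S : Finset (Vertex m k)) {t : ℝ}
    (ht : 0 ≤ t) : HasDerivWithinAt (fun t : ℝ => meanAge P V S t.toNNReal)
      (drift P r V S t.toNNReal) (Set.Ici t) t := by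
  refine hasDerivWithinAt_of_abs_sub_le (K := 2 * totalRate m k r ^ 2 *
    (∫ ω, (V t.toNNReal ω .source : ℝ) ∂P + 1)) fun δ hδ => ?_
  have := hR.abs_meanAge_sub_le S t.toNNReal δ.toNNReal
  rwa [← Real.toNNReal_add ht hδ, Real.coe_toNNReal δ hδ] at this

lemma continuousOn_meanAge (hR : IsRealization P r N V) (S : Finset (Vertex m k)) :
    ContinuousOn (fun t : ℝ => meanAge P V S t.toNNReal) (Set.Ici 0) := by
  obtain ⟨v, hv0, hv⟩ := hR.integral_source
  have hL : 0 ≤ totalRate m k r := Finset.sum_nonneg fun _ _ => by positivity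
  refine continuousOn_of_abs_sub_le (D := fun t => drift P r V S t.toNNReal)
    (B := fun t => totalRate m k r * (v + r.lamE * t + 1))
    (K := fun t => 2 * totalRate m k r ^ 2 * (v + r.lamE * t + 1)) ?_ ?_ ?_ ?_ ?_
  · intro s t hst
    dsimp only
    gcongr
  · intro s t hst
    dsimp only
    gcongr
  · intro t ht
    simpa [hv, ht] using hR.abs_drift_le S t.toNNReal
  · intro t ht
    positivity
  · intro t δ ht hδ
    have := hR.abs_meanAge_sub_le S t.toNNReal δ.toNNReal
    rwa [← Real.toNNReal_add ht hδ, Real.coe_toNNReal δ hδ, hv, Real.coe_toNNReal t ht] at this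

end IsRealization

end

/-! ### Arcs of a ring and the limits of their mean ages. -/

section

/-- The `j` consecutive positions on a ring that start at `c`. -/
def arc {l : ℕ} (c : ZMod l) (j : ℕ) : Finset (ZMod l) :=
  (Finset.range j).image fun i : ℕ => c + i

section Arc

variable {l : ℕ}

lemma mem_arc {c x : ZMod l} {j : ℕ} : x ∈ arc c j ↔ ∃ i < j, c + (i : ZMod l) = x := by
  simp [arc]

lemma arc_one (c : ZMod l) : arc c 1 = {c} := by simp [arc]

lemma card_arc (c : ZMod l) {j : ℕ} (hj : j ≤ l) : (arc c j).card = j := by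
  rw [arc, Finset.card_image_of_injOn, Finset.card_range]
  intro x hx y hy hxy
  simp only [Finset.coe_range, Set.mem_Iio] at hx hy
  have := (ZMod.natCast_eq_natCast_iff' x y l).1 (add_left_cancel hxy)
  rwa [Nat.mod_eq_of_lt (by omega), Nat.mod_eq_of_lt (by omega)] at this

lemma insert_arc_right (c : ZMod l) (j : ℕ) :
    insert (c + (j : ZMod l)) (arc c j) = arc c (j + 1) := by
  rw [arc, arc, Finset.range_add_one, Finset.image_insert]

lemma insert_arc_left (c : ZMod l) (j : ℕ) : insert (c - 1) (arc c j) = arc (c - 1) (j + 1) := by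
  ext x
  rw [Finset.mem_insert, mem_arc, mem_arc]
  constructor
  · rintro (rfl | ⟨i, hi, rfl⟩)
    · exact ⟨0, by omega, by simp⟩
    · exact ⟨i + 1, by omega, by push_cast; ring⟩
  · rintro ⟨i, hi, rfl⟩
    rcases i with _ | i
    · exact .inl (by simp)
    · exact .inr ⟨i, by omega, by push_cast; ring⟩

variable [NeZero l]

lemma arc_self (c : ZMod l) : arc c l = Finset.univ :=
  Finset.eq_univ_of_card _ (by rw [card_arc c le_rfl, ZMod.card])

/-- Only the two outer neighbours of an arc can enlarge it. -/
lemma sum_ringNeighbour_arc (ψ : Finset (ZMod l) → ℝ) (c : ZMod l) {j : ℕ} (hj : 1 ≤ j) :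
    ∑ i, ∑ b, (if ringNeighbour i b ∈ arc c j then ψ (insert i (arc c j)) - ψ (arc c j) else 0) =
      (ψ (arc (c - 1) (j + 1)) - ψ (arc c j)) + (ψ (arc c (j + 1)) - ψ (arc c j)) := by
  simp only [Fintype.sum_bool, Finset.sum_add_distrib, ringNeighbour, if_true, Bool.false_eq_true,
    if_false]
  congr 1
  -- A forward sender whose receiver lies in the arc is itself in the arc, where inserting it
  -- changes nothing, unless it is `c - 1`.
  · rw [Finset.sum_eq_single (c - 1), if_pos, insert_arc_left]
    · exact mem_arc.2 ⟨0, by omega, by simp⟩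
    · intro i _ hi
      split_ifs with h
      · obtain ⟨a, ha, hac⟩ := mem_arc.1 h
        rcases a with _ | a
        · exact absurd (by rw [← add_sub_cancel_right i 1, ← hac]; simp) hi
        · have hia : c + (a : ZMod l) = i := by
            push_cast at hac
            linear_combination hac
          rw [Finset.insert_eq_of_mem (mem_arc.2 ⟨a, by omega, hia⟩), sub_self]
      · rfl
    · simp
  · rw [Finset.sum_eq_single (c + (j : ZMod l)), if_pos, insert_arc_right]
    · refine mem_arc.2 ⟨j - 1, by omega, ?_⟩
      rw [Nat.cast_sub hj]
      push_cast
      ring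
    · intro i _ hi
      split_ifs with h
      · obtain ⟨a, ha, hac⟩ := mem_arc.1 h
        have hia : c + ((a + 1 : ℕ) : ZMod l) = i := by
          push_cast
          linear_combination hac
        have haj : a + 1 ≠ j := by
          rintro rfl
          exact hi hia.symm
        rw [Finset.insert_eq_of_mem (mem_arc.2 ⟨a + 1, by omega, hia⟩), sub_self]
      · rfl
    · simp

end Arc

/-- The limiting version age of an arc of `l - d` nodes of a ring of `l` nodes relative to a parent
that sends at total rate `a` into the ring; each node sends to its neighbours at total rate `b`. -/
noncomputable def arcAge (lamE a b : ℝ) (l : ℕ) : ℕ → ℝ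
  | 0 => lamE / a
  | d + 1 => (lamE + b * arcAge lamE a b l d) / (a / l * ((l : ℝ) - (d + 1)) + b)

/-- The limiting version age of a node of a ring relative to its parent. -/
noncomputable def ringAge (lamE a b : ℝ) (l : ℕ) : ℝ := arcAge lamE a b l (l - 1)

/-- Stated for an abstract parent age `H`, so that it serves the ring of heads (`H = 0`, the source)
and each cluster (`H` the mean age of its head). The induction is on the number `d` of nodes missing
from the arc. -/
lemma tendsto_arc {l : ℕ} [NeZero l] {lamE a b H₀ : ℝ} (ha : 0 < a) (hb : 0 < b)
    {F : Finset (ZMod l) → ℝ → ℝ} {H : ℝ → ℝ} (hH : Tendsto H atTop (𝓝 H₀))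
    (hc : ∀ A, ContinuousOn (F A) (Set.Ici 0))
    (hd : ∀ A t, 0 ≤ t → HasDerivWithinAt (F A) (lamE + a / l * A.card * (H t - F A t) +
      b / 2 * ∑ i, ∑ d, (if ringNeighbour i d ∈ A then F (insert i A) t - F A t else 0))
      (Set.Ici t) t) (d : ℕ) (hdl : d < l) (c : ZMod l) :
    Tendsto (F (arc c (l - d))) atTop (𝓝 (H₀ + arcAge lamE a b l d)) := by
  have hl : (0 : ℝ) < l := by exact_mod_cast Nat.pos_of_neZero l
  induction d generalizing c with
  | zero =>
    rw [Nat.sub_zero, arc_self]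
    have h1 : Tendsto (fun t => lamE + a * H t) atTop (𝓝 (lamE + a * H₀)) :=
      (hH.const_mul a).const_add lamE
    convert! tendsto_of_linear_ode ha (hc Finset.univ) (fun t ht => ?_) h1 using 2
    · rw [arcAge]
      field_simp
      ring
    · convert! hd Finset.univ t ht using 1
      simp only [Finset.card_univ, ZMod.card, Finset.mem_univ, if_true,
        Finset.insert_eq_of_mem, sub_self, Finset.sum_const_zero]
      field_simp
      ring
  | succ d ih =>
    have h1 : l - (d + 1) + 1 = l - d := by omega
    have hcast : ((l - (d + 1) : ℕ) : ℝ) = (l : ℝ) - (d + 1) := by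
      rw [Nat.cast_sub hdl.le]
      push_cast
      ring
    have hpos : 0 < a / l * ((l : ℝ) - (d + 1)) + b := by
      rw [← hcast]
      positivity
    have h2 := ((hH.const_mul (a / l * ((l : ℝ) - (d + 1)))).const_add lamE).add
      (((ih (by omega) (c - 1)).add (ih (by omega) c)).const_mul (b / 2))
    convert! tendsto_of_linear_ode hpos (hc (arc c (l - (d + 1)))) (fun t ht => ?_) h2 using 2
    · rw [arcAge, eq_div_iff hpos.ne', add_mul, div_mul_cancel₀ _ hpos.ne']
      ring
    · convert! hd (arc c (l - (d + 1))) t ht using 1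
      rw [sum_ringNeighbour_arc (fun A => F A t) c (by omega), card_arc c (by omega), h1, hcast]
      ring

variable {m k : ℕ} [NeZero m] [NeZero k] {Ω : Type*} [MeasurableSpace Ω] {P : Measure Ω}
  {r : Rates} {N : Event m k → ℝ≥0 → Ω → ℕ} {V : ℝ≥0 → Ω → Vertex m k → ℕ}

namespace IsRealization

variable [IsProbabilityMeasure P]

lemma integral_setAge_send_sub (hR : IsRealization P r N V) (S : Finset (Vertex m k)) (t : ℝ≥0)
    (v w : Vertex m k) (hw : w ≠ .source) :
    ∫ ω, (setAge S (send v w (V t ω)) - setAge S (V t ω)) ∂P =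
      if w ∈ S then meanAge P V (insert v S) t - meanAge P V S t else 0 := by
  simp only [setAge_send v w hw]
  split_ifs
  · exact integral_sub (hR.integrable_setAge _ t) (hR.integrable_setAge _ t)
  · simp

omit [NeZero m] [NeZero k] in
lemma integral_setAge_newVersion_sub (S : Finset (Vertex m k)) (hS : .source ∉ S) (t : ℝ≥0) :
    ∫ ω, (setAge S (Event.newVersion.act (V t ω)) - setAge S (V t ω)) ∂P = 1 := by
  simp [setAge_newVersion _ S hS]

lemma meanAge_insert_source (hR : IsRealization P r N V) (S : Finset (Vertex m k)) (t : ℝ≥0) :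
    meanAge P V (insert .source S) t = 0 := by
  refine integral_eq_zero_of_ae ?_
  filter_upwards [hR.ae_ordered_and_source t] with ω hω using hω.1.setAge_insert_source S

lemma meanAge_insert_head (hR : IsRealization P r N V) (c : ZMod m) (A : Finset (ZMod k))
    (t : ℝ≥0) :
    meanAge P V (insert (.head c) (A.image (.user c))) t = meanAge P V {.head c} t := by
  refine integral_congr_ae ?_
  filter_upwards [hR.ae_ordered_and_source t] with ω hω using hω.1.setAge_insert_head c A

lemma drift_heads (hR : IsRealization P r N V) (A : Finset (ZMod m)) (t : ℝ≥0) :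
    drift P r V (A.image .head) t =
      r.lamE + r.lamS / m * A.card * (0 - meanAge P V (A.image .head) t) +
      r.lamCA / 2 * ∑ i, ∑ d, (if ringNeighbour i d ∈ A then
        meanAge P V ((insert i A).image .head) t - meanAge P V (A.image .head) t else 0) := by
  rw [drift, sum_event, integral_setAge_newVersion_sub _ (by simp)]
  simp only [Event.act, hR.integral_setAge_send_sub _ _ _ (.head _) (by simp),
    hR.integral_setAge_send_sub _ _ _ (.user _ _) (by simp), Event.rate, hR.meanAge_insert_source, Finset.image_insert,
    ← Finset.mul_sum]
  simp [Finset.sum_ite_mem]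
  ring

/-- Only transmissions into cluster `c` contribute, and `meanAge_insert_head` replaces the enlarged
set by the head alone; this decouples the cluster from all others. -/
lemma drift_users (hR : IsRealization P r N V) (c : ZMod m) (A : Finset (ZMod k)) (t : ℝ≥0) :
    drift P r V (A.image (.user c)) t =
      r.lamE + r.lamCB / k * A.card *
        (meanAge P V {.head c} t - meanAge P V (A.image (.user c)) t) +
      r.lam / 2 * ∑ i, ∑ d, (if ringNeighbour i d ∈ A then
        meanAge P V ((insert i A).image (.user c)) t - meanAge P V (A.image (.user c)) t
          else 0) := by
  rw [drift, sum_event, integral_setAge_newVersion_sub _ (by simp)]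
  simp only [Event.act, hR.integral_setAge_send_sub _ _ _ (.head _) (by simp),
    hR.integral_setAge_send_sub _ _ _ (.user _ _) (by simp), Event.rate, Finset.image_insert, ← Finset.mul_sum]
  have h1 : ∀ g : ZMod m → ℝ, ∑ c', ∑ i, (if Vertex.user c' i ∈ A.image (Vertex.user c) then g c'
      else 0) = A.card * g c := fun g => by
    rw [Finset.sum_eq_single c]
    · simp [Finset.sum_ite_mem]
    · intro c' _ hc'
      simp [hc'.symm]
    · simp
  have h2 : ∀ g : ZMod m → ZMod k → ℝ, ∑ c', ∑ i, ∑ d,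
      (if Vertex.user c' (ringNeighbour i d) ∈ A.image (Vertex.user c) then g c' i else 0) =
      ∑ i, ∑ d, (if ringNeighbour i d ∈ A then g c i else 0) := fun g => by
    rw [Finset.sum_eq_single c]
    · simp
    · intro c' _ hc'
      simp [hc'.symm]
    · simp
  rw [h1 fun c' => meanAge P V (insert (.head c') (A.image (.user c))) t -
      meanAge P V (A.image (.user c)) t,
    h2 fun c' i => meanAge P V (insert (.user c' i) (A.image (.user c))) t -
      meanAge P V (A.image (.user c)) t, hR.meanAge_insert_head]
  simp only [Finset.mem_image, reduceCtorEq, and_false, exists_false, if_false,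
    Finset.sum_const_zero, mul_zero, add_zero, NNReal.coe_div, NNReal.coe_natCast,
    NNReal.coe_ofNat, mul_one]
  ring

lemma tendsto_meanAge_head (hR : IsRealization P r N V) (hS : 0 < r.lamS) (hCA : 0 < r.lamCA)
    (c : ZMod m) : Tendsto (fun t : ℝ => meanAge P V {.head c} t.toNNReal) atTop
      (𝓝 (ringAge r.lamE r.lamS r.lamCA m)) := by
  have hm := Nat.pos_of_neZero m
  have := tendsto_arc (l := m) (lamE := r.lamE) (a := r.lamS) (b := r.lamCA)
    (F := fun A t => meanAge P V (A.image .head) t.toNNReal) (H := fun _ => 0) hS hCA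
    tendsto_const_nhds (fun A => hR.continuousOn_meanAge _) (fun A t ht => by
      simpa only [hR.drift_heads] using hR.hasDerivWithinAt_meanAge (A.image .head) ht)
    (m - 1) (by omega) c
  rw [show m - (m - 1) = 1 by omega, arc_one] at this
  simpa [ringAge] using this

lemma tendsto_meanAge_user (hR : IsRealization P r N V) (hS : 0 < r.lamS) (hCA : 0 < r.lamCA)
    (hCB : 0 < r.lamCB) (hlam : 0 < r.lam) (c : ZMod m) (i : ZMod k) :
    Tendsto (fun t : ℝ => meanAge P V {.user c i} t.toNNReal) atTop
      (𝓝 (ringAge r.lamE r.lamS r.lamCA m + ringAge r.lamE r.lamCB r.lam k)) := by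
  have hk := Nat.pos_of_neZero k
  have := tendsto_arc (l := k) (lamE := r.lamE) (a := r.lamCB) (b := r.lam)
    (F := fun A t => meanAge P V (A.image (.user c)) t.toNNReal) hCB hlam
    (hR.tendsto_meanAge_head hS hCA c) (fun A => hR.continuousOn_meanAge _) (fun A t ht => by
      simpa only [hR.drift_users] using hR.hasDerivWithinAt_meanAge (A.image (.user c)) ht)
    (k - 1) (by omega) i
  rw [show k - (k - 1) = 1 by omega, arc_one] at this
  simpa [ringAge] using this

end IsRealization

end

/-! ### Gaussian asymptotics of `ringAge`. -/

section

/-- The weight `∏_{i ≤ s} (1 + α i / l)⁻¹`. -/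
noncomputable def ringWeight (α : ℝ) (l s : ℕ) : ℝ :=
  ∏ i ∈ Finset.range s, (1 + α * (i + 1) / l)⁻¹

lemma ringWeight_succ (α : ℝ) (l s : ℕ) :
    ringWeight α l (s + 1) = ringWeight α l s * (1 + α * (s + 1) / l)⁻¹ :=
  Finset.prod_range_succ _ _

lemma ringWeight_nonneg {α : ℝ} (hα : 0 < α) (l s : ℕ) : 0 ≤ ringWeight α l s :=
  Finset.prod_nonneg fun i _ => by positivity

lemma exp_le_ringWeight {α : ℝ} (hα : 0 < α) (l s : ℕ) :
    Real.exp (-(α * (s * (s + 1) / l) / 2)) ≤ ringWeight α l s := by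
  induction s with
  | zero => simp [ringWeight]
  | succ s ih =>
    have h : -(α * (((s + 1 : ℕ) : ℝ) * (((s + 1 : ℕ) : ℝ) + 1) / l) / 2) =
        -(α * (s * (s + 1) / l) / 2) + -(α * (s + 1) / l) := by
      push_cast
      ring
    rw [ringWeight_succ, h, Real.exp_add, Real.exp_neg (α * (s + 1) / l)]
    have := ringWeight_nonneg hα l s
    gcongr
    linarith [Real.add_one_le_exp (α * (s + 1) / l)]

/-- From `(1 + u)⁻¹ ≤ exp (-u / (1 + u))`, with `1 + u` bounded by its value at `M`. The choice `M =
s` is sharp when `s / l → 0`; `M = l` gives a Gaussian bound uniform in `l`. -/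
lemma ringWeight_le_exp {α : ℝ} (hα : 0 < α) (l : ℕ) {s M : ℕ} (hs : s ≤ M) :
    ringWeight α l s ≤ Real.exp (-(α * (s * (s + 1) / l) / 2 / (1 + α * (M / l)))) := by
  induction s with
  | zero => simp [ringWeight]
  | succ s ih =>
    set U := 1 + α * ((M : ℝ) / l) with hU
    have hU0 : 0 < U := by positivity
    have h : -(α * (((s + 1 : ℕ) : ℝ) * (((s + 1 : ℕ) : ℝ) + 1) / l) / 2 / U) =
        -(α * (s * (s + 1) / l) / 2 / U) + -(α * (s + 1) / l / U) := by
      push_cast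
      ring
    rw [ringWeight_succ, h, Real.exp_add]
    have h1 : (1 + α * (s + 1) / l)⁻¹ ≤ Real.exp (-(α * (s + 1) / l / U)) := by
      set u := α * ((s : ℝ) + 1) / l with hu
      have hu0 : 0 ≤ u := by positivity
      have huU : 1 + u ≤ U := by
        have : ((s : ℝ) + 1) ≤ M := by exact_mod_cast hs
        rw [hu, hU, mul_div_assoc]
        gcongr
      calc (1 + u)⁻¹ = -(u / (1 + u)) + 1 := by field_simp; ring
        _ ≤ Real.exp (-(u / (1 + u))) := Real.add_one_le_exp _
        _ ≤ _ := by gcongr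
    have := ringWeight_nonneg hα l s
    have := ih (by omega)
    gcongr

/-- The recursion unrolled `s` times from a single node: an arc of `j` nodes has denominator `b * (1
+ (a / b) * j / l)`. -/
lemma ringAge_eq {lamE a b : ℝ} (ha : 0 < a) (hb : 0 < b) {l s : ℕ} (hs : s < l) :
    ringAge lamE a b l = lamE / b * ∑ j ∈ Finset.range s, ringWeight (a / b) l (j + 1) +
      ringWeight (a / b) l s * arcAge lamE a b l (l - 1 - s) := by
  induction s with
  | zero => simp [ringAge, ringWeight]
  | succ s ih =>
    have hl : (0 : ℝ) < l := by exact_mod_cast (by omega : 0 < l)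
    have h1 : l - 1 - s = l - 1 - (s + 1) + 1 := by omega
    have h2 : ((l - 1 - (s + 1) : ℕ) : ℝ) = (l : ℝ) - (s + 2) := by
      rw [Nat.sub_sub, Nat.cast_sub (by omega)]
      push_cast
      ring
    rw [ih (by omega), h1, arcAge, h2, Finset.sum_range_succ, ringWeight_succ]
    have h3 : a / l * ((l : ℝ) - ((l : ℝ) - (s + 2) + 1)) + b =
        b * (1 + a / b * (s + 1) / l) := by
      field_simp
      ring
    have h4 : 0 < 1 + a / b * ((s : ℝ) + 1) / l := by positivity
    rw [h3]
    field_simp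
    ring

/-- Turns the scaled sum into the integral of a step function with cells of width `1 / s`, ready for
dominated convergence. -/
lemma integral_floor_step (f : ℕ → ℝ) (n : ℕ) {s : ℝ} (hs : 0 < s) :
    ∫ x in Set.Ioi (0 : ℝ), (if ⌊x * s⌋₊ < n then f ⌊x * s⌋₊ else 0) =
      (∑ j ∈ Finset.range n, f j) / s := by
  rw [← integral_Ici_eq_integral_Ioi]
  have h1 : ∀ x ∈ Set.Ici (0 : ℝ), (if ⌊x * s⌋₊ < n then f ⌊x * s⌋₊ else 0) =
      ∑ j ∈ Finset.range n, (Set.Ico ((j : ℝ) / s) ((j + 1) / s)).indicator (fun _ => f j) x := by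
    intro x hx
    have h2 : ∀ j : ℕ, x ∈ Set.Ico ((j : ℝ) / s) ((j + 1) / s) ↔ ⌊x * s⌋₊ = j := fun j => by
      rw [Nat.floor_eq_iff (mul_nonneg hx hs.le), Set.mem_Ico, div_le_iff₀ hs, lt_div_iff₀ hs]
    simp only [Set.indicator_apply, h2]
    rw [Finset.sum_ite_eq]
    simp
  rw [setIntegral_congr_fun measurableSet_Ici h1, integral_finsetSum, Finset.sum_div]
  · refine Finset.sum_congr rfl fun j _ => ?_
    rw [setIntegral_indicator measurableSet_Ico, Set.inter_eq_self_of_subset_right]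
    · have : (j : ℝ) / s ≤ (j + 1) / s := by gcongr; linarith
      rw [setIntegral_const, Real.volume_real_Ico_of_le this, smul_eq_mul]
      ring
    · exact fun x hx => (by positivity : (0 : ℝ) ≤ (j : ℝ) / s).trans hx.1
  · intro j _
    refine Integrable.integrableOn ?_
    rw [integrable_indicator_iff measurableSet_Ico]
    exact integrableOn_const (by simp)

lemma tendsto_sqrt_natCast : Tendsto (fun l : ℕ => √(l : ℝ)) atTop atTop :=
  Real.tendsto_sqrt_atTop.comp tendsto_natCast_atTop_atTop

lemma tendsto_floor_mul_sqrt_div {x : ℝ} (hx : 0 ≤ x) :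
    Tendsto (fun l : ℕ => ((⌊x * √(l : ℝ)⌋₊ + 1 : ℕ) : ℝ) / √(l : ℝ)) atTop (𝓝 x) := by
  have h1 := ((tendsto_nat_floor_mul_div_atTop hx).comp tendsto_sqrt_natCast).add
    (tendsto_inv_atTop_zero.comp tendsto_sqrt_natCast)
  rw [add_zero] at h1
  refine h1.congr fun l => ?_
  simp only [Function.comp, Nat.cast_add, Nat.cast_one]
  ring

lemma tendsto_ringWeight {α x : ℝ} (hα : 0 < α) (hx : 0 ≤ x) :
    Tendsto (fun l : ℕ => if ⌊x * √(l : ℝ)⌋₊ < l - 1 then ringWeight α l (⌊x * √(l : ℝ)⌋₊ + 1)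
      else 0) atTop (𝓝 (Real.exp (-(α / 2) * x ^ 2))) := by
  set s : ℕ → ℕ := fun l => ⌊x * √(l : ℝ)⌋₊ + 1 with hs
  have h1 : Tendsto (fun l => (s l : ℝ) / √(l : ℝ)) atTop (𝓝 x) := tendsto_floor_mul_sqrt_div hx
  have h0 : Tendsto (fun l : ℕ => (√(l : ℝ))⁻¹) atTop (𝓝 0) :=
    tendsto_inv_atTop_zero.comp tendsto_sqrt_natCast
  have hsq : ∀ l : ℕ, (√(l : ℝ))⁻¹ * (√(l : ℝ))⁻¹ = (l : ℝ)⁻¹ := fun l => by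
    rw [← mul_inv, Real.mul_self_sqrt (by positivity)]
  have h2 : Tendsto (fun l => (s l : ℝ) / l) atTop (𝓝 0) := by
    have := h1.mul h0
    rw [mul_zero] at this
    refine this.congr fun l => ?_
    rw [div_mul_eq_mul_div, div_eq_mul_inv, mul_assoc, hsq, div_eq_mul_inv]
  have h3 : Tendsto (fun l => (s l : ℝ) * (s l + 1) / l) atTop (𝓝 (x ^ 2)) := by
    have := (h1.mul h1).add h2
    rw [add_zero, ← sq] at this
    refine this.congr fun l => ?_
    have e : (s l : ℝ) / √(l : ℝ) * (s l / √(l : ℝ)) = s l * s l / l := by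
      rw [div_mul_div_comm, Real.mul_self_sqrt (by positivity)]
    rw [e]
    ring
  have h4 : ∀ᶠ l : ℕ in atTop, ⌊x * √(l : ℝ)⌋₊ < l - 1 := by
    filter_upwards [h2.eventually_lt_const (show (0 : ℝ) < 1 / 2 by norm_num),
      eventually_ge_atTop 2] with l hl hl2
    have hl0 : (0 : ℝ) < l := by positivity
    rw [div_lt_iff₀ hl0] at hl
    have : (2 * s l : ℕ) < l := by
      have : (2 : ℝ) * s l < l := by linarith
      exact_mod_cast this
    simp only [hs] at this
    omega
  have hlow : Tendsto (fun l => Real.exp (-(α * ((s l : ℝ) * (s l + 1) / l) / 2))) atTop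
      (𝓝 (Real.exp (-(α / 2) * x ^ 2))) := by
    have := (((h3.const_mul α).div_const 2).neg).rexp
    convert! this using 3
    ring
  have hup : Tendsto (fun l => Real.exp (-(α * ((s l : ℝ) * (s l + 1) / l) / 2 /
      (1 + α * ((s l : ℝ) / l))))) atTop (𝓝 (Real.exp (-(α / 2) * x ^ 2))) := by
    have := ((((h3.const_mul α).div_const 2).div ((h2.const_mul α).const_add 1)
      (by simp)).neg).rexp
    convert! this using 3
    simp
    ring
  refine tendsto_of_tendsto_of_tendsto_of_le_of_le' hlow hup ?_ ?_
  · filter_upwards [h4] with l hl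
    rw [if_pos hl]
    exact exp_le_ringWeight hα l (s l)
  · filter_upwards [h4] with l hl
    rw [if_pos hl]
    exact ringWeight_le_exp hα l le_rfl

lemma ringWeight_floor_le {α x : ℝ} (hα : 0 < α) (hx : 0 ≤ x) {l : ℕ} (hl : 0 < l) :
    ‖if ⌊x * √(l : ℝ)⌋₊ < l - 1 then ringWeight α l (⌊x * √(l : ℝ)⌋₊ + 1) else 0‖ ≤
      Real.exp (-(α / 2 / (1 + α)) * x ^ 2) := by
  split_ifs with h
  · set s := ⌊x * √(l : ℝ)⌋₊ + 1 with hs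
    have hl0 : (0 : ℝ) < l := by exact_mod_cast hl
    rw [Real.norm_of_nonneg (ringWeight_nonneg hα l s)]
    refine (ringWeight_le_exp hα l (M := l) (by omega)).trans ?_
    rw [div_self hl0.ne', mul_one, Real.exp_le_exp]
    have h1 : x * √(l : ℝ) ≤ s := by
      rw [hs]
      push_cast
      exact (Nat.lt_floor_add_one _).le
    have h2 : x ^ 2 ≤ s * (s + 1) / l := by
      rw [le_div_iff₀ hl0]
      calc x ^ 2 * l = (x * √(l : ℝ)) * (x * √(l : ℝ)) := by
            rw [mul_mul_mul_comm, Real.mul_self_sqrt hl0.le, sq]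
        _ ≤ s * s := by gcongr
        _ ≤ s * (s + 1) := by gcongr; linarith
    calc -(α * (s * (s + 1) / l) / 2 / (1 + α))
        = -(α / 2 / (1 + α)) * (s * (s + 1) / l) := by ring
      _ ≤ _ := mul_le_mul_of_nonpos_left h2 (by
          have : 0 < α / 2 / (1 + α) := by positivity
          linarith)
  · rw [norm_zero]
    positivity

lemma tendsto_sum_ringWeight {α : ℝ} (hα : 0 < α) :
    Tendsto (fun l : ℕ => (∑ j ∈ Finset.range (l - 1), ringWeight α l (j + 1)) / √(l : ℝ)) atTop
      (𝓝 (√(Real.pi / (α / 2)) / 2)) := by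
  rw [← integral_gaussian_Ioi]
  have h : Tendsto (fun l : ℕ => ∫ x in Set.Ioi (0 : ℝ), (if ⌊x * √(l : ℝ)⌋₊ < l - 1 then
      ringWeight α l (⌊x * √(l : ℝ)⌋₊ + 1) else 0)) atTop
      (𝓝 (∫ x in Set.Ioi (0 : ℝ), Real.exp (-(α / 2) * x ^ 2))) := by
    refine tendsto_integral_filter_of_dominated_convergence
      (fun x => Real.exp (-(α / 2 / (1 + α)) * x ^ 2)) (.of_forall fun l => ?_) ?_ ?_ ?_
    · exact ((measurable_of_countable fun j : ℕ => if j < l - 1 then ringWeight α l (j + 1)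
        else 0).comp (Nat.measurable_floor.comp
          (measurable_id.mul_const (√(l : ℝ))))).aestronglyMeasurable
    · filter_upwards [eventually_gt_atTop 0] with l hl
      exact (ae_restrict_mem measurableSet_Ioi).mono fun x hx =>
        ringWeight_floor_le hα (le_of_lt hx) hl
    · exact (integrable_exp_neg_mul_sq (by positivity)).integrableOn
    · exact (ae_restrict_mem measurableSet_Ioi).mono fun x hx =>
        tendsto_ringWeight hα (le_of_lt hx)
  refine h.congr' ?_
  filter_upwards [eventually_gt_atTop 0] with l hl
  exact integral_floor_step (fun j => ringWeight α l (j + 1)) (l - 1)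
    (Real.sqrt_pos.2 (by exact_mod_cast hl))

lemma tendsto_ringAge_div_sqrt {lamE a b : ℝ} (ha : 0 < a) (hb : 0 < b) :
    Tendsto (fun l : ℕ => ringAge lamE a b l / √(l : ℝ)) atTop
      (𝓝 (√(Real.pi / 2) * (lamE / √(a * b)))) := by
  have hα : 0 < a / b := by positivity
  have h1 := (tendsto_sum_ringWeight hα).const_mul (lamE / b)
  -- The remainder of the fully unrolled recursion is a weight at most `1` times the full-ring age
  -- `lamE / a`, negligible after division by `√l`.
  have h2 : Tendsto (fun l : ℕ => ringWeight (a / b) l (l - 1) * (lamE / a * (√(l : ℝ))⁻¹)) atTop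
      (𝓝 0) := by
    have h0 : Tendsto (fun l : ℕ => lamE / a * (√(l : ℝ))⁻¹) atTop (𝓝 0) := by
      simpa using (tendsto_inv_atTop_zero.comp tendsto_sqrt_natCast).const_mul (lamE / a)
    refine isBoundedUnder_le_mul_tendsto_zero (isBoundedUnder_of ⟨1, fun l => ?_⟩) h0
    simp only [Function.comp, Real.norm_of_nonneg (ringWeight_nonneg hα l (l - 1))]
    refine (ringWeight_le_exp hα l le_rfl).trans (Real.exp_le_one_iff.2 ?_)
    rw [neg_nonpos]
    positivity
  have h3 := h1.add h2
  have hconst : lamE / b * (√(Real.pi / (a / b / 2)) / 2) + 0 =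
      √(Real.pi / 2) * (lamE / √(a * b)) := by
    have e1 : Real.pi / (a / b / 2) = Real.pi / 2 * (2 * b) ^ 2 / (a * b) := by
      field_simp
    rw [e1, Real.sqrt_div (by positivity), Real.sqrt_mul (by positivity),
      Real.sqrt_sq (by positivity)]
    field_simp
    ring
  rw [hconst] at h3
  refine h3.congr' ?_
  filter_upwards [eventually_gt_atTop 0] with l hl
  rw [ringAge_eq ha hb (show l - 1 < l by omega), Nat.sub_self, arcAge]
  ring

lemma isLittleO_ringAge_sub {lamE a b : ℝ} (ha : 0 < a) (hb : 0 < b) :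
    (fun l : ℕ => ringAge lamE a b l - √(Real.pi / 2) * (lamE / √(a * b)) * √(l : ℝ)) =o[atTop]
      fun l : ℕ => √(l : ℝ) := by
  have hne : ∀ᶠ l : ℕ in atTop, √(l : ℝ) ≠ 0 := by
    filter_upwards [eventually_gt_atTop 0] with l hl
    exact (Real.sqrt_pos.2 (by exact_mod_cast hl)).ne'
  rw [Asymptotics.isLittleO_iff_tendsto' (hne.mono fun l h1 h2 => absurd h2 h1)]
  have := (tendsto_ringAge_div_sqrt (lamE := lamE) ha hb).sub_const
    (√(Real.pi / 2) * (lamE / √(a * b)))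
  rw [sub_self] at this
  refine this.congr' ?_
  filter_upwards [hne] with l hl
  field_simp

/-- Both leading terms are nonnegative, so each square root is bounded by a multiple of their sum
and the two errors are negligible against it, with no relation needed between the two ring sizes. -/
lemma isEquivalent_ringAge_add {lamE a b a' b' : ℝ} (hE : 0 < lamE) (ha : 0 < a) (hb : 0 < b)
    (ha' : 0 < a') (hb' : 0 < b') :
    Asymptotics.IsEquivalent (atTop ×ˢ atTop)
      (fun p : ℕ × ℕ => ringAge lamE a b p.1 + ringAge lamE a' b' p.2)
      (fun p : ℕ × ℕ => √(Real.pi / 2) * (lamE / √(a * b)) * √(p.1 : ℝ) +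
        √(Real.pi / 2) * (lamE / √(a' * b')) * √(p.2 : ℝ)) := by
  set c := √(Real.pi / 2) * (lamE / √(a * b)) with hc
  set c' := √(Real.pi / 2) * (lamE / √(a' * b')) with hc'
  have hpi := Real.pi_pos
  have hc0 : 0 < c := by positivity
  have hc0' : 0 < c' := by positivity
  have h1 : (fun p : ℕ × ℕ => √(p.1 : ℝ)) =O[atTop ×ˢ atTop]
      fun p : ℕ × ℕ => c * √(p.1 : ℝ) + c' * √(p.2 : ℝ) := by
    refine Asymptotics.IsBigO.of_bound c⁻¹ (.of_forall fun p => ?_)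
    rw [Real.norm_of_nonneg (by positivity), Real.norm_of_nonneg (by positivity),
      inv_mul_eq_div, le_div_iff₀ hc0]
    have : 0 ≤ c' * √(p.2 : ℝ) := by positivity
    linarith
  have h2 : (fun p : ℕ × ℕ => √(p.2 : ℝ)) =O[atTop ×ˢ atTop]
      fun p : ℕ × ℕ => c * √(p.1 : ℝ) + c' * √(p.2 : ℝ) := by
    refine Asymptotics.IsBigO.of_bound c'⁻¹ (.of_forall fun p => ?_)
    rw [Real.norm_of_nonneg (by positivity), Real.norm_of_nonneg (by positivity),
      inv_mul_eq_div, le_div_iff₀ hc0']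
    have : 0 ≤ c * √(p.1 : ℝ) := by positivity
    linarith
  have h3 := (((isLittleO_ringAge_sub (lamE := lamE) ha hb).comp_tendsto
    (tendsto_fst (f := atTop) (g := (atTop : Filter ℕ)))).trans_isBigO h1).add
    (((isLittleO_ringAge_sub (lamE := lamE) ha' hb').comp_tendsto
    (tendsto_snd (f := (atTop : Filter ℕ)) (g := atTop))).trans_isBigO h2)
  refine h3.congr_left fun p => ?_
  simp only [Function.comp, Pi.sub_apply, ← hc, ← hc']
  ring

lemma exists_ringAge_le {lamE a b : ℝ} (ha : 0 < a) (hb : 0 < b) :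
    ∃ C, ∀ l : ℕ, 1 ≤ l → |ringAge lamE a b l| ≤ C * √(l : ℝ) := by
  obtain ⟨C, hC⟩ := (Metric.isBounded_range_of_tendsto _
    (tendsto_ringAge_div_sqrt (lamE := lamE) ha hb)).exists_norm_le
  refine ⟨C, fun l hl => ?_⟩
  have h1 : 0 < √(l : ℝ) := Real.sqrt_pos.2 (by exact_mod_cast hl)
  have h2 := hC _ ⟨l, rfl⟩
  rwa [norm_div, Real.norm_of_nonneg h1.le, div_le_iff₀ h1] at h2

end

end ClusteredGossip

theorem mainTheorem2 (r : ClusteredGossip.Rates)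
    (hE : 0 < r.lamE) (hS : 0 < r.lamS) (hCA : 0 < r.lamCA) (hCB : 0 < r.lamCB)
    (hlam : 0 < r.lam) :
    ∃ Δ : ℕ → ℕ → ℝ,
      -- `Δ m k` is the limiting average version age of every user in every realization
      (∀ (m k : ℕ) (Ω : Type*) [MeasurableSpace Ω] (P : Measure Ω) [IsProbabilityMeasure P]
        (N : ClusteredGossip.Event m k → ℝ≥0 → Ω → ℕ)
        (V : ℝ≥0 → Ω → ClusteredGossip.Vertex m k → ℕ),
        1 ≤ m → 1 ≤ k → ClusteredGossip.IsRealization P r N V →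
        ∀ (c : ZMod m) (i : ZMod k),
          (∀ t, Integrable (fun ω => ClusteredGossip.age (V t ω) (.user c i)) P) ∧
          Tendsto (fun t => ∫ ω, ClusteredGossip.age (V t ω) (.user c i) ∂P) atTop
            (𝓝 (Δ m k))) ∧
      -- the approximation by a sum of two ring terms, for large `m` and `k`
      Asymptotics.IsEquivalent (atTop ×ˢ atTop)
        (fun p : ℕ × ℕ => Δ p.1 p.2)
        (fun p : ℕ × ℕ =>
          √(Real.pi / 2) * ((r.lamE : ℝ) / √((r.lamS : ℝ) * r.lamCA)) * √(p.1 : ℝ) +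
          √(Real.pi / 2) * ((r.lamE : ℝ) / √((r.lam : ℝ) * r.lamCB)) * √(p.2 : ℝ)) ∧
      -- the scaling for `m = k = √n`
      (∃ C : ℝ, ∀ n m k : ℕ, 1 ≤ n → n = m * k → m = k →
        |Δ m k| ≤ C * (n : ℝ) ^ (1 / 4 : ℝ)) := by

  refine ⟨fun m k => ClusteredGossip.ringAge r.lamE r.lamS r.lamCA m +
    ClusteredGossip.ringAge r.lamE r.lamCB r.lam k, ?_, ?_, ?_⟩
  · intro m k Ω _ P _ N V hm hk hR c i
    have : NeZero m := ⟨by omega⟩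
    have : NeZero k := ⟨by omega⟩
    simp only [← ClusteredGossip.setAge_singleton]
    refine ⟨hR.integrable_setAge _, ?_⟩
    have h := (hR.tendsto_meanAge_user hS hCA hCB hlam c i).comp
      (NNReal.tendsto_coe_atTop.2 tendsto_id)
    simpa only [Function.comp_def, id, Real.toNNReal_coe, ClusteredGossip.meanAge] using h
  · have h := ClusteredGossip.isEquivalent_ringAge_add (lamE := r.lamE) (a := r.lamS)
      (b := r.lamCA) (a' := r.lamCB) (b' := r.lam) hE hS hCA hCB hlam
    simpa only [mul_comm (r.lamCB : ℝ)] using h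
  · obtain ⟨C₁, h₁⟩ := ClusteredGossip.exists_ringAge_le (lamE := r.lamE) (a := r.lamS)
      (b := r.lamCA) hS hCA
    obtain ⟨C₂, h₂⟩ := ClusteredGossip.exists_ringAge_le (lamE := r.lamE) (a := r.lamCB)
      (b := r.lam) hCB hlam
    refine ⟨C₁ + C₂, fun n m k hn hnm hmk => ?_⟩
    subst hmk
    -- `m = 0` would give `n = 0`.
    have hm : 1 ≤ m := Nat.one_le_iff_ne_zero.2 (by rintro rfl; omega)
    have hsqrt : (n : ℝ) ^ (1 / 4 : ℝ) = √(m : ℝ) := by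
      rw [hnm, Nat.cast_mul, ← sq, ← Real.rpow_natCast, ← Real.rpow_mul (by positivity),
        Real.sqrt_eq_rpow]
      norm_num
    rw [hsqrt, add_mul]
    exact (abs_add_le _ _).trans (add_le_add (h₁ m hm) (h₂ m hm))
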